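/- Let $\mathbb K$ be a principal ideal domain and write $M^\vee=\mathrm{Hom}_{\mathbb K}(M,\mathbb K)$ and $M^\diamond=\mathrm{Ext}^1_{\mathbb K}(M,\mathbb K)$ for a $\mathbb K$-module $M$. Let $\Phi:\mathrm{Mod}(\mathbb K)\to\mathrm{Mod}(\mathbb K)$ be a (not necessarily additive) functor which takes finitely generated free modules to finitely generated free modules, and let $\Phi^\#$ be its Kuhn dual, $\Phi^\#(M)=\Phi(M^\vee)^\vee$. Let $A$ be a finitely generated free $\mathbb K$-module. Let $\mathsf{Pres}(A)$ be the category of epimorphisms $p:F\twoheadrightarrow A$ with $F$ free (morphisms are the homomorphisms over $A$), let $\mathsf R_A:\mathsf{Pres}(A)\to\mathrm{Mod}(\mathbb K)$, $\mathsf R_A(p)=\mathrm{Ker}(p)$, and let $\mathsf{lim}^i\,\Phi\mathsf R_A$ be the $i$-th right derived functor of the limit over $\mathsf{Pres}(A)$, evaluated at $\Phi\circ\mathsf R_A$. For $p\in\mathsf{Pres}(A)$ let $p^\bullet$ be the cosimplicial object of $\mathsf{Pres}(A)$ with $p^n=p^{\sqcup (n+1)}$, and let $\mathsf{Lim}_{(p)}\Phi\mathsf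 R_A=N^\bullet(\Phi\mathsf R_A(p^\bullet))$ be the normalized cochain complex (the intersection of the kernels of the codegeneracies, with the alternating sum of the cofaces as differential). For a simplicial module $V$ let $N_\bullet V$ be the normalized chain complex (the quotient by the images of the degeneracies). For a module $B$ let $K(B,n)$ be the simplicial module which corresponds under Dold–Kan to $B$ placed in degree $n$, and let $L_iF(B,n)=H_i\big(N_\bullet F(\mathsf{DK}_\bullet(P[n]))\big)$ be the Dold–Puppe derived functors of a functor $F$, where $P\to B$ is a projective resolution. Then there are isomorphisms of cochain complexes $$\mathsf{Lim}_{(\mathrm{id}_A)}\Phi\mathsf R_A\;\cong\;\big(N_\bullet\,\Phi^\#(K(A^\vee,1))\big)^\vee\;\cong\;\big(N_\bullet\,\Phi^\#(K(A,1))\big)^\vee ,$$ and for every $i\ge 0$ there is a short exact sequence of $\mathbb K$-modules $$0\to (L_{i-1}\Phi^\#(A^\vee,1))^\diamond\to \mathsf{lim}^i\,\Phi\mathsf R_A\to (L_i\Phi^\#(A^\vee,1))^\vee\to 0,$$ where $L_{-1}\Phi^\#(A^\vee,1)=0$. -/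

import Mathlib

open CategoryTheory CategoryTheory.Limits Opposite

universe w v u

noncomputable section

namespace RelLim

open scoped ZeroObject

/-! ### Normalized complexes of simplicial and cosimplicial modules -/

section Normalized

variable {K : Type v} [CommRing K]

theorem alternating_sum_mem {M : Type w} [AddCommGroup M] [Module K M] (P : Submodule K M) {n : ℕ}
    (f : Fin (n + 2) → M) (k : Fin (n + 1)) (hk : f k.castSucc = f k.succ)
    (hf : ∀ l, l ≠ k.castSucc → l ≠ k.succ → f l ∈ P) :
    ∑ l : Fin (n + 2), (-1 : ℤ) ^ (l : ℕ) • f l ∈ P := by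
  rw [← Finset.add_sum_erase _ _ (Finset.mem_univ k.castSucc),
    ← Finset.add_sum_erase _ _ (show k.succ ∈ Finset.univ.erase k.castSucc by
      simp [Fin.ext_iff]), ← add_assoc]
  refine Submodule.add_mem _ ?_ (Submodule.sum_mem _ fun l hl => ?_)
  · rw [hk, Fin.val_castSucc, Fin.val_succ, pow_succ, ← add_smul]
    simp
  · simp only [Finset.mem_erase, Finset.mem_univ, and_true, ne_eq] at hl
    exact zsmul_mem (hf l hl.2 hl.1) _

theorem hom_alternating_sum {M N P : ModuleCat.{w} K} {n : ℕ} (f : Fin n → (M ⟶ N)) (g : N ⟶ P)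
    (x : M) : g.hom ((∑ l : Fin n, (-1 : ℤ) ^ (l : ℕ) • f l).hom x) =
      ∑ l : Fin n, (-1 : ℤ) ^ (l : ℕ) • (f l ≫ g).hom x := by
  rw [ModuleCat.hom_sum, LinearMap.sum_apply, map_sum]
  exact Finset.sum_congr rfl fun l _ => map_zsmul g.hom _ _

theorem fin_cases_of_ne {j : ℕ} {l : Fin (j + 2)} {k : Fin (j + 1)} (h1 : l ≠ k.castSucc)
    (h2 : l ≠ k.succ) : ∃ m, ∃ h : j = m + 1, (∃ (l' : Fin (m + 2)) (k' : Fin (m + 1)),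
      l = Fin.cast (by omega) l'.castSucc ∧ k = Fin.cast (by omega) k'.succ ∧ l' ≤ k'.castSucc) ∨
      (∃ (l' : Fin (m + 2)) (k' : Fin (m + 1)),
      l = Fin.cast (by omega) l'.succ ∧ k = Fin.cast (by omega) k'.castSucc ∧
        k'.castSucc < l') := by
  obtain ⟨l, hl⟩ := l
  obtain ⟨k, hk⟩ := k
  simp only [Fin.castSucc_mk, Fin.succ_mk, ne_eq, Fin.mk.injEq] at h1 h2
  rcases j with _ | m
  · omega
  refine ⟨m, rfl, ?_⟩
  rcases lt_or_gt_of_ne h1 with h | h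
  · left
    refine ⟨⟨l, by omega⟩, ⟨k - 1, by omega⟩, ?_, ?_, ?_⟩ <;>
      simp [Fin.ext_iff, Fin.le_def] <;> omega
  · right
    refine ⟨⟨l - 1, by omega⟩, ⟨k, by omega⟩, ?_, ?_, ?_⟩ <;>
      simp [Fin.ext_iff, Fin.lt_def] <;> omega

/-- The submodule of `V_n` generated by the images of the degeneracy maps
`s_0, …, s_{n-1} : V_{n-1} → V_n`. -/
def degenerate (V : SimplicialObject (ModuleCat.{w} K)) :
    (n : ℕ) → Submodule K (((AlgebraicTopology.alternatingFaceMapComplex _).obj V).X n)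
  | 0 => ⊥
  | n + 1 => ⨆ i : Fin (n + 1), LinearMap.range (V.σ i).hom

theorem degenerate_le_comap (V : SimplicialObject (ModuleCat.{w} K)) (i j : ℕ) :
    degenerate V i ≤ (degenerate V j).comap
      (((AlgebraicTopology.alternatingFaceMapComplex _).obj V).d i j).hom := by
  by_cases hij : j + 1 = i
  · subst hij
    refine iSup_le fun k => ?_
    rintro _ ⟨y, rfl⟩
    rw [Submodule.mem_comap]
    have hd : ((AlgebraicTopology.alternatingFaceMapComplex _).obj V).d (j + 1) j =
        ∑ l : Fin (j + 2), (-1 : ℤ) ^ (l : ℕ) • V.δ l :=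
      AlgebraicTopology.AlternatingFaceMapComplex.obj_d_eq V j
    rw [hd]
    have hsum : (∑ l : Fin (j + 2), (-1 : ℤ) ^ (l : ℕ) • V.δ l).hom ((V.σ k).hom y) =
        ∑ l : Fin (j + 2), (-1 : ℤ) ^ (l : ℕ) • (V.σ k ≫ V.δ l).hom y := by
      rw [ModuleCat.hom_sum, LinearMap.sum_apply]
      rfl
    refine hsum ▸ alternating_sum_mem (degenerate V j) _ k ?_ fun l h1 h2 => ?_
    · rw [SimplicialObject.δ_comp_σ_self, SimplicialObject.δ_comp_σ_succ]
    · obtain ⟨m, rfl, ⟨l, k, rfl, rfl, h⟩ | ⟨l, k, rfl, rfl, h⟩⟩ := fin_cases_of_ne h1 h2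
      · exact Submodule.mem_iSup_of_mem k ⟨(V.δ l).hom y,
          (congrArg (fun g => g.hom y) (V.δ_comp_σ_of_le h)).symm⟩
      · exact Submodule.mem_iSup_of_mem k ⟨(V.δ l).hom y,
          (congrArg (fun g => g.hom y) (V.δ_comp_σ_of_gt h)).symm⟩
  · rw [((AlgebraicTopology.alternatingFaceMapComplex _).obj V).shape i j hij]
    intro x _
    exact Submodule.zero_mem _

/-- The normalized chain complex `N_• V` of a simplicial module: in degree `n` it is the quotient
of `V_n` by the images of the degeneracy maps, with the differential induced by the alternating
sum of the face maps. -/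
def normalizedChain (V : SimplicialObject (ModuleCat.{w} K)) :
    ChainComplex (ModuleCat.{w} K) ℕ where
  X n := ModuleCat.of K
    ((((AlgebraicTopology.alternatingFaceMapComplex _).obj V).X n) ⧸ degenerate V n)
  d i j := ModuleCat.ofHom (Submodule.mapQ _ _
    (((AlgebraicTopology.alternatingFaceMapComplex _).obj V).d i j).hom
    (degenerate_le_comap V i j))
  shape i j hij := by
    ext x
    exact congrArg (fun g => (degenerate V j).mkQ (g.hom x))
      (((AlgebraicTopology.alternatingFaceMapComplex _).obj V).shape i j hij)
  d_comp_d' i j k _ _ := by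
    ext x
    exact congrArg (fun g => (degenerate V k).mkQ (g.hom x))
      (((AlgebraicTopology.alternatingFaceMapComplex _).obj V).d_comp_d i j k)

/-- The submodule of `W^n` of the elements killed by all codegeneracy maps
`s^0, …, s^{n-1} : W^n → W^{n-1}`. -/
def conormalized (W : CosimplicialObject (ModuleCat.{w} K)) :
    (n : ℕ) → Submodule K (((AlgebraicTopology.alternatingCofaceMapComplex _).obj W).X n)
  | 0 => ⊤
  | n + 1 => ⨅ i : Fin (n + 1), LinearMap.ker (W.σ i).hom

theorem conormalized_le_comap (W : CosimplicialObject (ModuleCat.{w} K)) (i j : ℕ) :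
    ∀ x ∈ conormalized W i,
      (((AlgebraicTopology.alternatingCofaceMapComplex _).obj W).d i j).hom x ∈
        conormalized W j := by
  intro x hx
  by_cases hij : i + 1 = j
  · subst hij
    refine (Submodule.mem_iInf _).2 fun k => ?_
    have hd : ((AlgebraicTopology.alternatingCofaceMapComplex _).obj W).d i (i + 1) =
        ∑ l : Fin (i + 2), (-1 : ℤ) ^ (l : ℕ) • W.δ l :=
      CochainComplex.of_d (fun n => W.obj (SimplexCategory.mk n))
        (AlgebraicTopology.AlternatingCofaceMapComplex.objD W) i
    rw [hd]
    have hsum : (W.σ k).hom ((∑ l : Fin (i + 2), (-1 : ℤ) ^ (l : ℕ) • W.δ l).hom x) =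
        ∑ l : Fin (i + 2), (-1 : ℤ) ^ (l : ℕ) • (W.δ l ≫ W.σ k).hom x := by
      exact hom_alternating_sum _ _ _
    refine hsum.trans ((Submodule.mem_bot K).1 (alternating_sum_mem ⊥ _ k ?_ fun l h1 h2 => ?_))
    · rw [CosimplicialObject.δ_comp_σ_self, CosimplicialObject.δ_comp_σ_succ]
    · rw [Submodule.mem_bot]
      obtain ⟨m, rfl, ⟨l, k, rfl, rfl, h⟩ | ⟨l, k, rfl, rfl, h⟩⟩ := fin_cases_of_ne h1 h2
      · refine (congrArg (fun g => g.hom x) (W.δ_comp_σ_of_le h)).trans ?_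
        exact (congrArg (W.δ l).hom ((Submodule.mem_iInf _).1 hx k)).trans (map_zero (W.δ l).hom)
      · refine (congrArg (fun g => g.hom x) (W.δ_comp_σ_of_gt h)).trans ?_
        exact (congrArg (W.δ l).hom ((Submodule.mem_iInf _).1 hx k)).trans (map_zero (W.δ l).hom)
  · rw [((AlgebraicTopology.alternatingCofaceMapComplex _).obj W).shape i j hij]
    exact Submodule.zero_mem _

/-- The normalized cochain complex `N^• W` of a cosimplicial module: in degree `n` it is the
intersection of the kernels of the codegeneracy maps, with the differential given by the
alternating sum of the coface maps. -/
def normalizedCochain (W : CosimplicialObject (ModuleCat.{w} K)) :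
    CochainComplex (ModuleCat.{w} K) ℕ where
  X n := ModuleCat.of K (conormalized W n)
  d i j := ModuleCat.ofHom
    ((((AlgebraicTopology.alternatingCofaceMapComplex _).obj W).d i j).hom.restrict
      (conormalized_le_comap W i j))
  shape i j hij := by
    ext x
    exact congrArg (fun g => g.hom x.1)
      (((AlgebraicTopology.alternatingCofaceMapComplex _).obj W).shape i j hij)
  d_comp_d' i j k _ _ := by
    ext x
    exact congrArg (fun g => g.hom x.1)
      (((AlgebraicTopology.alternatingCofaceMapComplex _).obj W).d_comp_d i j k)

end Normalized

/-! ### Higher limits and the standard complex -/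

section HigherLimits

variable (J : Type (u + 1)) [Category.{u} J] (K : Type u) [CommRing K]

theorem isGrothendieckAbelian_module : IsGrothendieckAbelian.{u + 1} (ModuleCat.{u + 1} K) :=
  IsGrothendieckAbelian.of_equivalence
    (ModuleCat.restrictScalarsEquivalenceOfRingEquiv (ULift.ringEquiv.{u, u + 1} (R := K)).symm)

theorem isGrothendieckAbelian_functor (M : Type (u + 2)) [Category.{u + 1} M] [Abelian M]
    [IsGrothendieckAbelian.{u + 1} M] : IsGrothendieckAbelian.{u + 1} (J ⥤ M) := by
  have := hasColimitsOfSizeShrink.{u, u, u + 1, u + 1} M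
  have : HasCoproducts.{u} M := inferInstance
  have : IsGrothendieckAbelian.{u + 1} (Jᵒᵖᵒᵖ ⥤ M) :=
    { ab5OfSize := { ofShape := fun _ _ _ => inferInstance }
      hasSeparator := Presheaf.hasSeparator Jᵒᵖ _ }
  exact IsGrothendieckAbelian.of_equivalence (opOpEquivalence J).congrLeft

instance hasLimitsOfShape_module : HasLimitsOfShape J (ModuleCat.{u + 1} K) :=
  (ModuleCat.hasLimitsOfSize.{u, u + 1, u + 1, u} :
    HasLimitsOfSize.{u, u + 1} (ModuleCat.{u + 1} K)).has_limits_of_shape J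

instance enoughInjectives_functor : EnoughInjectives (J ⥤ ModuleCat.{u + 1} K) :=
  have := isGrothendieckAbelian_module K
  have := isGrothendieckAbelian_functor J (ModuleCat.{u + 1} K)
  inferInstance

instance lim_additive : (lim : (J ⥤ ModuleCat.{u + 1} K) ⥤ ModuleCat.{u + 1} K).Additive :=
  have : (Functor.const J : ModuleCat.{u + 1} K ⥤ J ⥤ ModuleCat.{u + 1} K).Additive := { }
  Adjunction.right_adjoint_additive constLimAdj

variable {J K}

/-- The higher limit `lim^i F`: the `i`-th right derived functor of the limit functor. Since the
index category may be large relative to the modules, everything takes place in the next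
universe. -/
def higherLim (F : J ⥤ ModuleCat.{u} K) (i : ℕ) : ModuleCat.{u + 1} K :=
  ((lim : (J ⥤ ModuleCat.{u + 1} K) ⥤ ModuleCat.{u + 1} K).rightDerived i).obj
    (F ⋙ ModuleCat.uliftFunctor.{u + 1} K)

variable [∀ n : ℕ, HasCoproductsOfShape (Fin (n + 1)) J]

/-- The cosimplicial object `c^•` with `(c^•)^n` the coproduct of `n + 1` copies of `c`; the map
induced by `θ : [m] → [n]` sends the `i`-th copy of `c` identically to the `θ i`-th copy. -/
def copowers (c : J) : CosimplicialObject J where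
  obj Δ := ∐ fun _ : Fin (Δ.len + 1) => c
  map {Δ Δ'} θ := Sigma.desc fun i : Fin (Δ.len + 1) =>
    Sigma.ι (fun _ : Fin (Δ'.len + 1) => c) (θ.toOrderHom i)
  map_id Δ := by
    refine Sigma.hom_ext _ _ fun i => ?_
    simp
  map_comp f g := by
    refine Sigma.hom_ext _ _ fun i => ?_
    simp

/-- The standard complex `Lim_(c) F = N^•(F(c^•))`. -/
def limComplex (c : J) (F : J ⥤ ModuleCat.{u} K) : CochainComplex (ModuleCat.{u} K) ℕ :=
  normalizedCochain (((CosimplicialObject.whiskering _ _).obj F).obj (copowers c))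

end HigherLimits

/-! ### The category of presentations and the relation functor -/

section Presentations

variable {K : Type u} [CommRing K]

/-- The category of free presentations of `A`: the full subcategory of the category of modules
over `A` on the epimorphisms `F ↠ A` with `F` free. -/
abbrev Pres (A : ModuleCat.{u} K) : Type (u + 1) :=
  ObjectProperty.FullSubcategory
    (fun p : Over A => Module.Free K p.left ∧ Function.Surjective p.hom.hom)

/-- The relation functor `R_A`, sending a presentation `p` to `Ker p`. -/
def relations (A : ModuleCat.{u} K) : Pres A ⥤ ModuleCat.{u} K where
  obj p := ModuleCat.of K (LinearMap.ker p.obj.hom.hom)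
  map {p q} f := ModuleCat.ofHom (f.hom.left.hom.restrict (fun x hx => by
    have h := congrArg (fun g => g.hom x) (Over.w f.hom)
    exact h.trans hx))

/-- The presentation of a free module given by the identity map. -/
def idPres (A : ModuleCat.{u} K) [hA : Module.Free K A] : Pres A :=
  ⟨Over.mk (𝟙 A), hA, Function.surjective_id⟩

/-- The map `⨁ F_i → A` induced by a finite family of presentations `p_i : F_i ↠ A`. -/
abbrev coprodHom {A : ModuleCat.{u} K} {n : ℕ} (p : Fin n → Pres A) :
    (∀ i, (p i).obj.left) →ₗ[K] A :=
  ∑ i, (p i).obj.hom.hom ∘ₗ LinearMap.proj (φ := fun i => (p i).obj.left) i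

theorem coprodHom_single {A : ModuleCat.{u} K} {n : ℕ} (p : Fin n → Pres A) (i : Fin n)
    (x : (p i).obj.left) : coprodHom p (Pi.single i x) = (p i).obj.hom.hom x := by
  rw [LinearMap.sum_apply, Finset.sum_eq_single i]
  · simp
  · intro j _ hj
    simp [Pi.single_eq_of_ne hj]
  · simp

/-- The coproduct of a nonempty finite family of presentations `p_i : F_i ↠ A` is
`⨁ F_i ↠ A`. -/
def coprodPres {A : ModuleCat.{u} K} {n : ℕ} (p : Fin (n + 1) → Pres A) : Pres A where
  obj := Over.mk (ModuleCat.ofHom (coprodHom p) : ModuleCat.of K (∀ i, (p i).obj.left) ⟶ A)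
  property := by
    refine ⟨?_, fun a => ?_⟩
    · have := fun i => (p i).property.1
      exact Module.Free.pi K _
    · obtain ⟨x, hx⟩ := (p 0).property.2 a
      exact ⟨Pi.single 0 x, (coprodHom_single p 0 x).trans hx⟩

/-- The coproduct cofan. -/
def coprodCofan {A : ModuleCat.{u} K} {n : ℕ} (p : Fin (n + 1) → Pres A) : Cofan p :=
  Cofan.mk (coprodPres p) fun i => ObjectProperty.homMk
    (Over.homMk (ModuleCat.ofHom (LinearMap.single K (fun i => (p i).obj.left) i)) (by
      ext x
      exact coprodHom_single p i x))

/-- The map out of `⨁ F_i` induced by a cofan. -/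
abbrev coprodDesc {A : ModuleCat.{u} K} {n : ℕ} (p : Fin (n + 1) → Pres A) (s : Cofan p) :
    (∀ i, (p i).obj.left) →ₗ[K] s.pt.obj.left :=
  ∑ i, (s.inj i).hom.left.hom ∘ₗ LinearMap.proj (φ := fun i => (p i).obj.left) i

theorem coprodDesc_single {A : ModuleCat.{u} K} {n : ℕ} (p : Fin (n + 1) → Pres A) (s : Cofan p)
    (i : Fin (n + 1)) (x : (p i).obj.left) :
    coprodDesc p s (Pi.single i x) = (s.inj i).hom.left.hom x := by
  rw [LinearMap.sum_apply, Finset.sum_eq_single i]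
  · simp
  · intro j _ hj
    simp [Pi.single_eq_of_ne hj]
  · simp

/-- The coproduct cofan is a colimit. -/
def coprodIsColimit {A : ModuleCat.{u} K} {n : ℕ} (p : Fin (n + 1) → Pres A) :
    IsColimit (coprodCofan p) :=
  Cofan.IsColimit.mk _
    (fun s => ObjectProperty.homMk (Over.homMk (ModuleCat.ofHom (coprodDesc p s)) (by
        ext : 1
        refine LinearMap.pi_ext fun i x => ?_
        refine Eq.trans ?_ (coprodHom_single p i x).symm
        refine (congrArg s.pt.obj.hom.hom (coprodDesc_single p s i x)).trans ?_
        exact congrArg (fun g => g.hom x) (Over.w (s.inj i).hom))))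
    (fun s i => by
      ext x
      exact coprodDesc_single p s i x)
    (fun s m hm => by
      apply ObjectProperty.hom_ext
      apply Over.OverMorphism.ext
      ext : 1
      refine LinearMap.pi_ext fun i x => ?_
      refine Eq.trans ?_ (coprodDesc_single p s i x).symm
      exact congrArg (fun g => g.hom.left.hom x) (hm i))

instance hasCoproducts_pres (A : ModuleCat.{u} K) (n : ℕ) :
    HasCoproductsOfShape (Fin (n + 1)) (Pres A) :=
  ⟨fun F =>
    have : HasColimit (Discrete.functor (F.obj ∘ Discrete.mk)) :=
      HasColimit.mk ⟨_, coprodIsColimit _⟩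
    hasColimit_of_iso Discrete.natIsoFunctor⟩

end Presentations

/-! ### Duality -/

section Duality

variable {K : Type u} [CommRing K]

/-- The dual module `M^∨ = Hom(M, K)`. -/
abbrev dualMod (M : ModuleCat.{u} K) : ModuleCat.{u} K := ModuleCat.of K (Module.Dual K M)

/-- The transpose `N^∨ → M^∨` of a map `M → N`. -/
abbrev dualMap {M N : ModuleCat.{u} K} (f : M ⟶ N) : dualMod N ⟶ dualMod M :=
  ModuleCat.ofHom f.hom.dualMap

/-- The module `M^◇ = Ext¹(M, K)`. -/
abbrev extDual (M : ModuleCat.{u} K) : Type u := Abelian.Ext.{u} M (ModuleCat.of K K) 1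

/-- The dual cochain complex of a chain complex. -/
def dualComplex (X : ChainComplex (ModuleCat.{u} K) ℕ) : CochainComplex (ModuleCat.{u} K) ℕ where
  X n := dualMod (X.X n)
  d i j := dualMap (X.d j i)
  shape i j hij := by
    rw [X.shape j i hij]
    ext f x
    exact map_zero f
  d_comp_d' i j k _ _ := by
    ext f x
    exact (congrArg (fun g => f (g.hom x)) (X.d_comp_d k j i)).trans (map_zero f)

/-- The Kuhn dual `Φ^#(M) = Φ(M^∨)^∨` of a functor. -/
def kuhnDual (Φ : ModuleCat.{u} K ⥤ ModuleCat.{u} K) : ModuleCat.{u} K ⥤ ModuleCat.{u} K where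
  obj M := dualMod (Φ.obj (dualMod M))
  map f := dualMap (Φ.map (dualMap f))
  map_id M := by
    have h : dualMap (𝟙 M) = 𝟙 (dualMod M) := rfl
    rw [h, Φ.map_id]
    rfl
  map_comp f g := by
    have h : dualMap (f ≫ g) = dualMap g ≫ dualMap f := rfl
    rw [h, Φ.map_comp]
    rfl

end Duality

/-! ### Eilenberg–MacLane objects and Dold–Puppe derived functors -/

section DoldPuppe

variable {K : Type u} [CommRing K]

/-- The simplicial module `F(V)` obtained by applying `F` degreewise. -/
abbrev applySimplicial (F : ModuleCat.{u} K ⥤ ModuleCat.{u} K)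
    (V : SimplicialObject (ModuleCat.{u} K)) : SimplicialObject (ModuleCat.{u} K) :=
  ((SimplicialObject.whiskering _ _).obj F).obj V

/-- The simplicial module `K(B, n)`: the Dold–Kan object of the chain complex with `B`
in degree `n` and zero elsewhere. -/
def eilenbergMacLane (B : ModuleCat.{u} K) (n : ℕ) : SimplicialObject (ModuleCat.{u} K) :=
  AlgebraicTopology.DoldKan.Γ₀.obj
    ((HomologicalComplex.single (ModuleCat.{u} K) (ComplexShape.down ℕ) n).obj B)

/-- The shift `P[1]` of a chain complex, with `P[1]_0 = 0` and `P[1]_{i+1} = P_i`. -/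
def shiftOne (P : ChainComplex (ModuleCat.{u} K) ℕ) : ChainComplex (ModuleCat.{u} K) ℕ :=
  P.augment (0 : P.X 0 ⟶ 0) comp_zero

/-- The derived functor `L_i F(B, n)` in the sense of Dold and Puppe: the `i`-th homotopy group
of `F` applied to the Dold–Kan object of `P[n]`, where `P` is a projective resolution of `B`. -/
def doldPuppe (F : ModuleCat.{u} K ⥤ ModuleCat.{u} K) (B : ModuleCat.{u} K) (n i : ℕ) :
    ModuleCat.{u} K :=
  (normalizedChain (applySimplicial F (AlgebraicTopology.DoldKan.Γ₀.obj
    (shiftOne^[n] (projectiveResolution B).complex)))).homology i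

end DoldPuppe

end RelLim

end

/-! The argument joins three computations through the cosimplicial module `Φ(R_A(c^•))`, where `c`
is the identity presentation of `A`.

Its shape. The `n`-th copower of `c` is the sum map `A^{n+1} → A`, whose kernel is generated by the
relations `ι_i a - ι_0 a`. The simplicial module dual to these kernels has Moore complex `A^∨` in
degree 1, so by Dold–Kan it is `K(A^∨, 1)` (`nonempty_gamma_iso`, `nonempty_eilenbergMacLane_iso`).
The kernels and their images under `Φ` are finitely generated free, hence reflexive, and biduality
turns `Φ(R_A(c^•))` into the dual of `Φ^#(K(A^∨, 1))` (`nonempty_cosimplicial_iso`). Dualizing turns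
the quotient by degeneracies into the joint kernel of the codegeneracies. This gives the
isomorphisms of complexes, a basis of `A` supplying `A ≅ A^∨`.

Its cohomology is the higher limit. As `A` is free, `c` is weakly initial. For any functor `F`, the
kernel of the first coface difference of `F(c^•)` is therefore `lim F`. For injective `F` the
complex is exact in positive degrees: `F` is a retract of a coinduced functor, whose complex is
contracted by prepending a chosen map `c ⟶ d` (`coinduced_exact`, `injective_exact`). An injective
resolution `I` then gives a double complex `I^q(c^p)` whose two edges compute `lim^n F` and the
cohomology of `F(c^•)`, and a staircase chase identifies them (`nonempty_edge_equiv`).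

Its predual computes Dold–Puppe functors. A projective resolution of the free module `A^∨` is chain
homotopy equivalent to `A^∨` in degree 0. Since `Φ^#` need not be additive, this equivalence has to
become a simplicial one before `Φ^#` is applied. The Dold–Kan object of `C` is modelled by the chain
maps from normalized chains of simplices to `C` (`nonempty_gammaModel_iso`), and on this model a
chain homotopy yields an explicit simplicial homotopy (`gammaModelHomotopy`). Hence `L_i Φ^#(A^∨,
1)` is the homology of `Φ^#(K(A^∨, 1))` (`nonempty_doldPuppe_iso`).

The exact sequence is then the universal coefficient sequence over a principal ideal domain
(`exists_universal_coefficients`). In degree 0 the `Ext` term is absent and the sequence is an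
isomorphism. -/

noncomputable section

namespace RelLim

/-! ### Concrete homology modules -/

section ConcreteHomology

variable {K : Type u} [CommRing K]

/-- The homology `ker g / im f` of a pair of linear maps. -/
abbrev midHomology {A B C : Type*} [AddCommGroup A] [AddCommGroup B] [AddCommGroup C] [Module K A]
    [Module K B] [Module K C] (f : A →ₗ[K] B) (g : B →ₗ[K] C) :=
  LinearMap.ker g ⧸ (LinearMap.range f).submoduleOf (LinearMap.ker g)

/-- The invariance of `ker g / im f` under isomorphisms of the middle term. -/
def midHomologyCongr {A B C A' B' C' : Type*} [AddCommGroup A] [AddCommGroup B] [AddCommGroup C]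
    [Module K A] [Module K B] [Module K C] [AddCommGroup A'] [AddCommGroup B'] [AddCommGroup C']
    [Module K A'] [Module K B'] [Module K C']
    {f : A →ₗ[K] B} {g : B →ₗ[K] C} {f' : A' →ₗ[K] B'} {g' : B' →ₗ[K] C'} (e : B ≃ₗ[K] B')
    (hg : ∀ x, g x = 0 ↔ g' (e x) = 0)
    (hf : ∀ x, x ∈ LinearMap.range f ↔ e x ∈ LinearMap.range f') :
    midHomology f g ≃ₗ[K] midHomology f' g' :=
  have hk : (LinearMap.ker g).map (e : B →ₗ[K] B') = LinearMap.ker g' := by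
    ext y
    obtain ⟨x, rfl⟩ := e.surjective y
    simp [hg]
  Submodule.Quotient.equiv _ _ (e.ofSubmodules _ _ hk) (by
    ext ⟨y, hy⟩
    obtain ⟨x, rfl⟩ := e.surjective y
    constructor
    · rintro ⟨z, hz, h⟩
      have h' : e z.1 = e x := congrArg Subtype.val h
      have hx : z.1 = x := e.injective h'
      change e x ∈ LinearMap.range f'
      rw [← hf, ← hx]
      exact hz
    · intro h
      have hx : x ∈ LinearMap.ker g := (hg x).2 hy
      refine ⟨⟨x, hx⟩, ?_, rfl⟩
      exact (hf x).2 h)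

/-- The homology of a short complex of modules in concrete terms. -/
def shortComplexHomologyEquiv (S : ShortComplex (ModuleCat.{v} K)) :
    S.homology ≃ₗ[K] midHomology S.f.hom S.g.hom :=
  S.moduleCatHomologyIso.toLinearEquiv ≪≫ₗ Submodule.quotEquivOfEq _ _ (by
    ext x
    constructor
    · rintro ⟨y, rfl⟩
      exact ⟨y, rfl⟩
    · rintro ⟨y, hy⟩
      exact ⟨y, Subtype.ext hy⟩)

/-- The homology of a complex of modules in concrete terms. -/
def homologyEquiv {ι : Type*} {c : ComplexShape ι} (X : HomologicalComplex (ModuleCat.{v} K) c)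
    (i j k : ι) (hi : c.prev j = i) (hk : c.next j = k) :
    X.homology j ≃ₗ[K] midHomology (X.d i j).hom (X.d j k).hom :=
  (ShortComplex.homologyMapIso (X.isoSc' i j k hi hk)).toLinearEquiv ≪≫ₗ
    shortComplexHomologyEquiv (X.sc' i j k)

end ConcreteHomology

/-! ### The universal coefficient sequence -/

section UniversalCoefficients

variable {K : Type u} [CommRing K]

/-- For a short exact sequence `0 → B → Z → M → 0` with `Z` projective, `Ext¹(M, K)` is the
cokernel of `Z^∨ → B^∨`. -/
theorem exists_connecting {B Z : Type u} [AddCommGroup B] [Module K B] [AddCommGroup Z]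
    [Module K Z] (M : ModuleCat.{u} K) [Module.Projective K Z] (a : B →ₗ[K] Z) (q : Z →ₗ[K] M)
    (ha : Function.Injective a) (haq : Function.Exact a q) (hq : Function.Surjective q) :
    ∃ δ : Module.Dual K B →ₗ[K] extDual M, Function.Surjective δ ∧
      LinearMap.ker δ = LinearMap.range a.dualMap := by
  let S : ShortComplex (ModuleCat.{u} K) :=
    ShortComplex.mk (ModuleCat.ofHom a) (ModuleCat.ofHom q : ModuleCat.of K Z ⟶ M) (by
      ext x
      exact haq.apply_apply_eq_zero x)
  have hS : S.ShortExact := ModuleCat.shortComplex_shortExact S haq ha hq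
  have : Projective S.X₂ := by
    rw [← IsProjective.iff_projective]
    assumption
  let δ' := (hS.extClass.precompOfLinear K (ModuleCat.of K K) (add_zero 1))
  let e : Module.Dual K B ≃ₗ[K] Abelian.Ext.{u} S.X₁ (ModuleCat.of K K) 0 :=
    (ModuleCat.homLinearEquiv (S := K) (M := S.X₁) (N := ModuleCat.of K K)).symm ≪≫ₗ
      (Abelian.Ext.linearEquiv₀ (R := K)).symm
  refine ⟨δ' ∘ₗ e.toLinearMap, ?_, ?_⟩
  · intro x
    obtain ⟨y, hy⟩ := Abelian.Ext.contravariant_sequence_exact₃ hS _ x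
      (Abelian.Ext.eq_zero_of_projective _) (add_zero 1)
    exact ⟨e.symm y, by simpa [δ'] using hy⟩
  · ext φ
    constructor
    · intro h
      obtain ⟨y, hy⟩ := Abelian.Ext.contravariant_sequence_exact₁ hS _ (e φ) (add_zero 1) h
      obtain ⟨y, rfl⟩ := (Abelian.Ext.linearEquiv₀ (R := K)).symm.surjective y
      refine ⟨y.hom, ?_⟩
      rw [show (Abelian.Ext.linearEquiv₀ (R := K)).symm y = Abelian.Ext.mk₀ y from rfl,
        Abelian.Ext.mk₀_comp_mk₀] at hy
      have h2 := (Abelian.Ext.mk₀_bijective S.X₁ (ModuleCat.of K K)).1 (hy.trans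
        (show e φ = Abelian.Ext.mk₀ (ModuleCat.ofHom φ) from rfl))
      exact congrArg ModuleCat.Hom.hom h2
    · rintro ⟨y, rfl⟩
      change hS.extClass.comp (Abelian.Ext.mk₀ (S.f ≫ ModuleCat.ofHom y)) (add_zero 1) = 0
      rw [← Abelian.Ext.mk₀_comp_mk₀, ShortComplex.ShortExact.extClass_comp_assoc]

/-- A section `s` of `d` makes the kernel a direct summand with projection `1 - s d`, and composing
with this projection extends functionals. -/
theorem exists_extend_of_projective_quotient {X P : Type*} [AddCommGroup X] [Module K X]
    [AddCommGroup P] [Module K P] [Module.Projective K P] (d : X →ₗ[K] P)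
    (hd : Function.Surjective d) (ψ : LinearMap.ker d →ₗ[K] K) :
    ∃ φ : X →ₗ[K] K, ∀ x : LinearMap.ker d, φ x = ψ x := by
  obtain ⟨s, hs⟩ := Module.projective_lifting_property d LinearMap.id hd
  have hs' : ∀ p, d (s p) = p := fun p => LinearMap.congr_fun hs p
  let r : X →ₗ[K] LinearMap.ker d := (LinearMap.id - s ∘ₗ d).codRestrict _ (fun x => by
    simp [hs'])
  refine ⟨ψ ∘ₗ r, fun x => congrArg ψ (Subtype.ext ?_)⟩
  have := x.2
  simp only [LinearMap.mem_ker] at this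
  simp [r, this]

/-- The degree zero part of the universal coefficient sequence. -/
theorem nonempty_dual_midHomology_zero {X₁ X₀ Y : Type*}
    [AddCommGroup X₁] [AddCommGroup X₀] [AddCommGroup Y]
    [Module K X₁] [Module K X₀] [Module K Y] (d₁ : X₁ →ₗ[K] X₀) :
    Nonempty (LinearMap.ker d₁.dualMap ≃ₗ[K]
      Module.Dual K (midHomology d₁ (0 : X₀ →ₗ[K] Y))) := by
  let q : X₀ →ₗ[K] midHomology d₁ (0 : X₀ →ₗ[K] Y) :=
    Submodule.mkQ _ ∘ₗ LinearMap.id.codRestrict _ (fun x => rfl)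
  have hq : Function.Surjective q := fun y => by
    obtain ⟨z, rfl⟩ := Submodule.Quotient.mk_surjective _ y
    exact ⟨z.1, rfl⟩
  have hq0 : ∀ x, q (d₁ x) = 0 := fun x => (Submodule.Quotient.mk_eq_zero _).2 ⟨x, rfl⟩
  refine ⟨(LinearEquiv.ofBijective (q.dualMap.codRestrict _ (fun φ => ?_)) ⟨?_, ?_⟩).symm⟩
  · ext x
    exact (congrArg φ (hq0 x)).trans (map_zero φ)
  · intro φ ψ h
    exact LinearMap.dualMap_injective_of_surjective hq (congrArg Subtype.val h)
  · rintro ⟨φ, hφ⟩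
    refine ⟨Submodule.liftQ _ (φ ∘ₗ Submodule.subtype _) ?_, ?_⟩
    · rintro ⟨x, hx⟩ ⟨y, hy : d₁ y = x⟩
      subst hy
      exact LinearMap.congr_fun hφ y
    · rfl

variable [IsDomain K] [IsPrincipalIdealRing K]

/-- A functional on the boundaries `im d₁` pulls back along `d₁` to a cocycle, which is a coboundary
exactly when the functional extends to `X₀`, equivalently to the cycles `ker d₀`. So the cokernel of
restriction from cycles to boundaries, which is `Ext¹(M₀, K)`, embeds in `H`. The other map
evaluates cocycles on cycles. Both extension problems are solvable because images in free modules
over a principal ideal domain are projective, so cycles are direct summands. -/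
theorem exists_universal_coefficients {X₂ X₁ X₀ : Type u} {Y : Type*}
    [AddCommGroup X₂] [AddCommGroup X₁] [AddCommGroup X₀] [AddCommGroup Y] [Module K X₂]
    [Module K X₁] [Module K X₀] [Module K Y] [Module.Free K X₁] [Module.Finite K X₁]
    [Module.Free K X₀] [Module.Finite K X₀] [Module.Free K Y] [Module.Finite K Y]
    (d₂ : X₂ →ₗ[K] X₁) (d₁ : X₁ →ₗ[K] X₀) (d₀ : X₀ →ₗ[K] Y) (h₂ : d₁ ∘ₗ d₂ = 0) (h₁ : d₀ ∘ₗ d₁ = 0)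
    (M₀ M₁ : ModuleCat.{u} K) (e₀ : midHomology d₁ d₀ ≃ₗ[K] M₀) (e₁ : midHomology d₂ d₁ ≃ₗ[K] M₁)
    {H : Type*} [AddCommGroup H] [Module K H]
    (e : midHomology d₁.dualMap d₂.dualMap ≃ₗ[K] H) :
    ∃ (f : extDual M₀ →ₗ[K] H) (g : H →ₗ[K] dualMod M₁),
      Function.Injective f ∧ Function.Exact f g ∧ Function.Surjective g := by
  have h₁' : ∀ x, d₀ (d₁ x) = 0 := fun x => LinearMap.congr_fun h₁ x
  have h₂' : ∀ x, d₁ (d₂ x) = 0 := fun x => LinearMap.congr_fun h₂ x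
  let a : LinearMap.range d₁ →ₗ[K] LinearMap.ker d₀ :=
    Submodule.inclusion (LinearMap.range_le_ker_iff.2 h₁)
  let q : LinearMap.ker d₀ →ₗ[K] M₀ := e₀.toLinearMap ∘ₗ Submodule.mkQ _
  have haq : Function.Exact a q := by
    intro x
    rw [show q x = e₀ (Submodule.Quotient.mk x) from rfl, LinearEquiv.map_eq_zero_iff,
      Submodule.Quotient.mk_eq_zero]
    constructor
    · intro h
      exact ⟨⟨x.1, h⟩, rfl⟩
    · rintro ⟨y, rfl⟩
      exact y.2
  obtain ⟨δ, hδ, hδ'⟩ := exists_connecting M₀ a q (Submodule.inclusion_injective _) haq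
    (e₀.surjective.comp (Submodule.mkQ_surjective _))
  -- The image of `d₀` is a submodule of the free module `Y`, hence projective.
  have extendZ : ∀ ψ : LinearMap.ker d₀ →ₗ[K] K, ∃ φ : X₀ →ₗ[K] K,
      ∀ x : LinearMap.ker d₀, φ x = ψ x := by
    intro ψ
    obtain ⟨φ, hφ⟩ := exists_extend_of_projective_quotient d₀.rangeRestrict
      d₀.surjective_rangeRestrict
      (ψ ∘ₗ (LinearEquiv.ofEq _ _ (LinearMap.ker_rangeRestrict d₀)).toLinearMap)
    exact ⟨φ, fun x => hφ ⟨x.1, by simp⟩⟩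
  -- the map from functionals on the boundaries to the cohomology
  let t₀ : Module.Dual K (LinearMap.range d₁) →ₗ[K] LinearMap.ker d₂.dualMap :=
    d₁.rangeRestrict.dualMap.codRestrict _ (fun φ => by
      ext x
      refine (congrArg φ (Subtype.ext ?_)).trans (map_zero φ)
      exact h₂' x)
  let t : Module.Dual K (LinearMap.range d₁) →ₗ[K] H := e.toLinearMap ∘ₗ Submodule.mkQ _ ∘ₗ t₀
  have ht : LinearMap.ker t = LinearMap.ker δ := by
    rw [hδ']
    ext φ
    have h1 : φ ∈ LinearMap.ker t ↔ ∃ ψ : Module.Dual K X₀, d₁.dualMap ψ =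
        d₁.rangeRestrict.dualMap φ := by
      change e (Submodule.Quotient.mk (t₀ φ)) = 0 ↔ _
      rw [LinearEquiv.map_eq_zero_iff, Submodule.Quotient.mk_eq_zero]
      rfl
    rw [h1]
    constructor
    · rintro ⟨ψ, hψ⟩
      refine ⟨ψ ∘ₗ (LinearMap.ker d₀).subtype, ?_⟩
      ext ⟨_, x, rfl⟩
      exact LinearMap.congr_fun hψ x
    · rintro ⟨ψ, rfl⟩
      obtain ⟨φ, hφ⟩ := extendZ ψ
      refine ⟨φ, ?_⟩
      ext x
      exact hφ ⟨d₁ x, h₁' x⟩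
  -- the evaluation map
  let ev₀ : LinearMap.ker d₂.dualMap →ₗ[K] Module.Dual K (midHomology d₂ d₁) :=
    { toFun := fun φ => Submodule.liftQ _ (φ.1 ∘ₗ (LinearMap.ker d₁).subtype) (by
        rintro ⟨x, hx⟩ ⟨y, hy : d₂ y = x⟩
        subst hy
        exact LinearMap.congr_fun φ.2 y)
      map_add' := fun φ ψ => by
        ext x
        rfl
      map_smul' := fun c φ => by
        ext x
        rfl }
  have hev₀ : ∀ (φ : LinearMap.ker d₂.dualMap) (x : LinearMap.ker d₁),
      ev₀ φ (Submodule.Quotient.mk x) = φ.1 x.1 := fun φ x => rfl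
  let ev : midHomology d₁.dualMap d₂.dualMap →ₗ[K] Module.Dual K (midHomology d₂ d₁) :=
    Submodule.liftQ _ ev₀ (by
      rintro ⟨_, hφ⟩ ⟨ψ, rfl⟩
      rw [LinearMap.mem_ker]
      ext x
      refine (congrArg ψ ?_).trans (map_zero ψ)
      exact x.2)
  let g : H →ₗ[K] dualMod M₁ :=
    e₁.symm.toLinearMap.dualMap ∘ₗ ev ∘ₗ e.symm.toLinearMap
  have hg0 : ∀ φ : LinearMap.ker d₂.dualMap, g (e (Submodule.Quotient.mk φ)) = 0 ↔
      ∀ x ∈ LinearMap.ker d₁, φ.1 x = 0 := by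
    intro φ
    have h1 : g (e (Submodule.Quotient.mk φ)) = e₁.symm.toLinearMap.dualMap (ev₀ φ) := by
      simp only [g, LinearMap.comp_apply, LinearEquiv.coe_coe, LinearEquiv.symm_apply_apply]
      rfl
    rw [h1]
    constructor
    · intro h x hx
      have := LinearMap.congr_fun h (e₁ (Submodule.Quotient.mk ⟨x, hx⟩))
      simp only [LinearMap.dualMap_apply, LinearEquiv.coe_coe,
        LinearEquiv.symm_apply_apply] at this
      exact this
    · intro h
      ext y
      obtain ⟨z, hz⟩ := Submodule.Quotient.mk_surjective _ (e₁.symm y)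
      rw [LinearMap.dualMap_apply, LinearEquiv.coe_coe, ← hz, hev₀]
      exact h _ z.2
  refine ⟨(LinearMap.ker δ).liftQ t ht.ge ∘ₗ
    (δ.quotKerEquivOfSurjective hδ).symm.toLinearMap, g, ?_, ?_, ?_⟩
  · refine Function.Injective.comp (g := (LinearMap.ker δ).liftQ t ht.ge) ?_
      (LinearEquiv.injective _)
    rw [← LinearMap.ker_eq_bot, Submodule.ker_liftQ, ht, Submodule.mkQ_map_self]
  · intro y
    obtain ⟨y, rfl⟩ := e.surjective y
    obtain ⟨φ, rfl⟩ := Submodule.Quotient.mk_surjective _ y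
    rw [hg0]
    constructor
    · intro h
      -- A cocycle that vanishes on cycles descends to `X₁ / ker d₁ ≅ im d₁`, so it comes from a
      -- functional on the boundaries.
      let ψ₀ : (X₁ ⧸ LinearMap.ker d₁) →ₗ[K] K := Submodule.liftQ _ φ.1 h
      let ψ : Module.Dual K (LinearMap.range d₁) :=
        ψ₀ ∘ₗ d₁.quotKerEquivRange.symm.toLinearMap
      refine ⟨δ ψ, ?_⟩
      have h1 : (δ.quotKerEquivOfSurjective hδ).symm (δ ψ) = Submodule.Quotient.mk ψ := by
        rw [LinearEquiv.symm_apply_eq]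
        rfl
      rw [LinearMap.comp_apply, LinearEquiv.coe_coe, h1]
      change e (Submodule.Quotient.mk (t₀ ψ)) = _
      congr 2
      apply Subtype.ext
      ext x
      change ψ₀ (d₁.quotKerEquivRange.symm (d₁.rangeRestrict x)) = _
      rw [show d₁.quotKerEquivRange.symm (d₁.rangeRestrict x) = Submodule.Quotient.mk x by
        rw [LinearEquiv.symm_apply_eq]
        rfl]
      rfl
    · rintro ⟨z, hz⟩
      obtain ⟨ψ, rfl⟩ := hδ z
      have h1 : (δ.quotKerEquivOfSurjective hδ).symm (δ ψ) = Submodule.Quotient.mk ψ := by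
        rw [LinearEquiv.symm_apply_eq]
        rfl
      rw [LinearMap.comp_apply, LinearEquiv.coe_coe, h1] at hz
      change e (Submodule.Quotient.mk (t₀ ψ)) = _ at hz
      rw [← hg0, ← hz, hg0]
      intro x hx
      refine (congrArg ψ (Subtype.ext ?_)).trans (map_zero ψ)
      exact hx
  · intro χ
    -- Surjectivity: a functional on homology is read on the cycles and extended to `X₁`. The
    -- extension is a cocycle because it still vanishes on boundaries.
    obtain ⟨φ, hφ⟩ := exists_extend_of_projective_quotient d₁.rangeRestrict
      d₁.surjective_rangeRestrict
      (χ ∘ₗ e₁.toLinearMap ∘ₗ Submodule.mkQ _ ∘ₗ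
        (LinearEquiv.ofEq _ _ (LinearMap.ker_rangeRestrict d₁)).toLinearMap)
    have hφ' : ∀ x : LinearMap.ker d₁, φ x = χ (e₁ (Submodule.Quotient.mk x)) :=
      fun x => hφ ⟨x.1, by simp⟩
    have hφ2 : φ ∈ LinearMap.ker d₂.dualMap := by
      rw [LinearMap.mem_ker]
      ext x
      refine (hφ' ⟨d₂ x, h₂' x⟩).trans ?_
      have h0 : (Submodule.Quotient.mk ⟨d₂ x, h₂' x⟩ : midHomology d₂ d₁) = 0 :=
        (Submodule.Quotient.mk_eq_zero _).2 (show d₂ x ∈ LinearMap.range d₂ from ⟨x, rfl⟩)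
      rw [h0, map_zero, map_zero]
      rfl
    refine ⟨e (Submodule.Quotient.mk ⟨φ, hφ2⟩), ?_⟩
    ext y
    obtain ⟨y, rfl⟩ := e₁.surjective y
    obtain ⟨z, rfl⟩ := Submodule.Quotient.mk_surjective _ y
    simp only [g, LinearMap.comp_apply, LinearEquiv.coe_coe, LinearEquiv.symm_apply_apply,
      LinearMap.dualMap_apply]
    exact hφ' z

end UniversalCoefficients

/-! ### Normalization -/

section Normalization

open AlgebraicTopology AlgebraicTopology.DoldKan

variable {K : Type v} [CommRing K] (V : SimplicialObject (ModuleCat.{w} K))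

/-- Every summand in the decomposition of `QInfty` ends with a degeneracy. Since `PInfty + QInfty =
1`, the projector `PInfty` is therefore the identity modulo degenerate elements; as it also kills
those, it descends to a section of the normalization. -/
theorem QInfty_mem_degenerate (n : ℕ) (x : ((alternatingFaceMapComplex _).obj V).X n) :
    ((QInfty : (alternatingFaceMapComplex _).obj V ⟶ _).f n).hom x ∈ degenerate V n := by
  rcases n with _ | n
  · rw [QInfty_f_0]
    exact Submodule.zero_mem _
  · rw [QInfty_f, decomposition_Q, ModuleCat.hom_sum, LinearMap.sum_apply]
    refine Submodule.sum_mem _ fun i _ => ?_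
    exact Submodule.mem_iSup_of_mem (Fin.rev i) ⟨_, rfl⟩

theorem PInfty_eq_zero_of_mem_degenerate (n : ℕ) :
    degenerate V n ≤ LinearMap.ker
      ((PInfty : (alternatingFaceMapComplex _).obj V ⟶ _).f n).hom := by
  rcases n with _ | n
  · exact bot_le
  · refine iSup_le fun i => ?_
    rintro _ ⟨y, rfl⟩
    exact congrArg (fun g => g.hom y) (σ_comp_PInfty V i)

/-- The projection onto the normalized chain complex. -/
def toNormalizedChain : (alternatingFaceMapComplex _).obj V ⟶ normalizedChain V where
  f n := ModuleCat.ofHom (degenerate V n).mkQ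
  comm' _ _ _ := rfl

/-- The section of the projection onto the normalized chain complex given by `PInfty`. -/
def ofNormalizedChain : normalizedChain V ⟶ (alternatingFaceMapComplex _).obj V where
  f n := ModuleCat.ofHom ((degenerate V n).liftQ _ (PInfty_eq_zero_of_mem_degenerate V n))
  comm' i j _ := by
    ext x
    obtain ⟨x, rfl⟩ := Submodule.Quotient.mk_surjective _ x
    exact congrArg (fun g => g.hom x)
      ((PInfty : (alternatingFaceMapComplex _).obj V ⟶ _).comm i j)

/-- The normalization theorem: a simplicial module has the same homology as its normalized chain
complex. -/
def normalizedHomologyIso (n : ℕ) :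
    ((alternatingFaceMapComplex _).obj V).homology n ≅ (normalizedChain V).homology n :=
  HomotopyEquiv.toHomologyIso
    { hom := toNormalizedChain V
      inv := ofNormalizedChain V
      homotopyHomInvId := (Homotopy.ofEq (show toNormalizedChain V ≫ ofNormalizedChain V =
        (PInfty : (alternatingFaceMapComplex _).obj V ⟶ _) by
          ext n x
          rfl)).trans (homotopyPInftyToId V)
      homotopyInvHomId := Homotopy.ofEq (by
        ext n x
        obtain ⟨x, rfl⟩ := Submodule.Quotient.mk_surjective _ x
        refine (Submodule.Quotient.eq _).2 ?_
        have h := congrArg (fun g => g.hom x) (PInfty_f_add_QInfty_f (X := V) n)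
        have h2 := QInfty_mem_degenerate V n x
        have h3 : ∀ {M : Type w} [AddCommGroup M] {a b c : M}, a + b = c → a - c = -b :=
          fun h => by rw [← h]; abel
        exact h3 h ▸ Submodule.neg_mem _ h2) } n

end Normalization

/-! ### Simplicial homotopies -/

section Cylinder

variable {C : Type*} [Category C]

/-- The map `[n] → [1]` whose value at `i` is `0` exactly if `i < k`. -/
def threshold (n k : ℕ) : SimplexCategory.mk n ⟶ SimplexCategory.mk 1 :=
  SimplexCategory.mkHom
    { toFun := fun i => if i.val < k then 0 else 1
      monotone' := fun i j hij => by
        have : i.val ≤ j.val := hij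
        dsimp only
        split_ifs <;> first | omega | simp }

theorem threshold_apply (n k : ℕ) (i : Fin (n + 1)) :
    (threshold n k).toOrderHom i = if i.val < k then 0 else 1 := rfl

theorem δ_comp_threshold_of_le {n k : ℕ} (i : Fin (n + 2)) (hk : k ≤ i.val) :
    SimplexCategory.δ i ≫ threshold (n + 1) k = threshold n k := by
  ext j : 3
  change (threshold (n + 1) k).toOrderHom (i.succAbove j) = (threshold n k).toOrderHom j
  simp only [threshold_apply]
  rcases lt_or_ge j.castSucc i with h | h
  · rw [Fin.succAbove_of_castSucc_lt _ _ h]; rfl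
  · rw [Fin.succAbove_of_le_castSucc _ _ h]
    have h' : i.val ≤ j.val := h
    rw [if_neg (by simp; omega), if_neg (by omega)]

theorem δ_comp_threshold_of_lt {n k : ℕ} (i : Fin (n + 2)) (hk : i.val ≤ k) :
    SimplexCategory.δ i ≫ threshold (n + 1) (k + 1) = threshold n k := by
  ext j : 3
  change (threshold (n + 1) (k + 1)).toOrderHom (i.succAbove j) = (threshold n k).toOrderHom j
  simp only [threshold_apply]
  rcases lt_or_ge j.castSucc i with h | h
  · rw [Fin.succAbove_of_castSucc_lt _ _ h]
    have h' : j.val < i.val := h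
    rw [if_pos (by simp; omega), if_pos (by omega)]
  · rw [Fin.succAbove_of_le_castSucc _ _ h]
    simp

theorem σ_comp_threshold_of_le {n k : ℕ} (i : Fin (n + 1)) (hk : k ≤ i.val) :
    SimplexCategory.σ i ≫ threshold n k = threshold (n + 1) k := by
  ext j : 3
  change (threshold n k).toOrderHom (i.predAbove j) = (threshold (n + 1) k).toOrderHom j
  simp only [threshold_apply]
  rcases le_or_gt j i.castSucc with h | h
  · rw [Fin.predAbove_of_le_castSucc _ _ h]; rfl
  · rw [Fin.predAbove_of_castSucc_lt _ _ h]
    have h' : i.val < j.val := h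
    rw [if_neg (by simp; omega), if_neg (by omega)]

theorem σ_comp_threshold_of_lt {n k : ℕ} (i : Fin (n + 1)) (hk : i.val < k) :
    SimplexCategory.σ i ≫ threshold n k = threshold (n + 1) (k + 1) := by
  ext j : 3
  change (threshold n k).toOrderHom (i.predAbove j) = (threshold (n + 1) (k + 1)).toOrderHom j
  simp only [threshold_apply]
  rcases le_or_gt j i.castSucc with h | h
  · rw [Fin.predAbove_of_le_castSucc _ _ h]
    have h' : j.val ≤ i.val := h
    change (if j.val < k then (0 : Fin 2) else 1) = _
    rw [if_pos (by omega), if_pos (by omega)]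
  · rw [Fin.predAbove_of_castSucc_lt _ _ h]
    have h' : i.val < j.val := h
    rw [Fin.val_pred]
    by_cases hj : j.val < k + 1
    · rw [if_pos hj, if_pos (by omega)]
    · rw [if_neg hj, if_neg (by omega)]

/-- A natural family of maps `X_n → Y_n` indexed by the simplices of the interval is a simplicial
homotopy. -/
def homotopyOfCylinder {X Y : SimplicialObject C} {f g : X ⟶ Y}
    (H : ∀ {n : ℕ} (_ : SimplexCategory.mk n ⟶ SimplexCategory.mk 1),
      X.obj (op (SimplexCategory.mk n)) ⟶ Y.obj (op (SimplexCategory.mk n)))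
    (hH : ∀ {n m : ℕ} (θ : SimplexCategory.mk m ⟶ SimplexCategory.mk n)
      (w : SimplexCategory.mk n ⟶ SimplexCategory.mk 1),
      H w ≫ Y.map θ.op = X.map θ.op ≫ H (θ ≫ w))
    (H0 : ∀ n, H (threshold n (n + 1)) = f.app _) (H1 : ∀ n, H (threshold n 0) = g.app _) :
    SimplicialObject.Homotopy f g :=
  have hδ : ∀ {n : ℕ} (i : Fin (n + 2)) (w : SimplexCategory.mk (n + 1) ⟶ SimplexCategory.mk 1),
      H w ≫ Y.δ i = X.δ i ≫ H (SimplexCategory.δ i ≫ w) := fun i w => hH _ w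
  have hσ : ∀ {n : ℕ} (i : Fin (n + 1)) (w : SimplexCategory.mk n ⟶ SimplexCategory.mk 1),
      H w ≫ Y.σ i = X.σ i ≫ H (SimplexCategory.σ i ≫ w) := fun i w => hH _ w
  -- The `i`-th simplex of the standard triangulation of the prism has its vertices `0, …, i` over
  -- `0` and the remaining ones over `1`.
  { h := fun {n} i => X.σ i ≫ H (threshold (n + 1) (i.val + 1))
    h_zero_comp_δ_zero := fun n => by
      rw [Category.assoc, hδ, δ_comp_threshold_of_lt _ (by simp), ← Category.assoc]
      have h := X.δ_comp_σ_self (n := n) (i := 0)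
      rw [Fin.castSucc_zero] at h
      rw [h, Category.id_comp]
      exact H1 n
    h_last_comp_δ_last := fun n => by
      rw [Category.assoc, hδ, δ_comp_threshold_of_le _ (by simp), ← Category.assoc]
      have h := X.δ_comp_σ_succ (i := Fin.last n)
      rw [Fin.succ_last] at h
      rw [h, Category.id_comp]
      exact H0 n
    h_succ_comp_δ_castSucc_of_lt := fun {n} i j hij => by
      have hij' : i.val ≤ j.val := hij
      rw [Category.assoc, hδ, ← Category.assoc, ← Category.assoc, X.δ_comp_σ_of_le hij]
      rw [Fin.val_succ, δ_comp_threshold_of_lt _ (by simp; omega)]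
    h_succ_comp_δ_castSucc_succ := fun {n} j => by
      rw [Category.assoc, hδ, Category.assoc, hδ, ← Category.assoc, ← Category.assoc,
        X.δ_comp_σ_succ]
      have h := X.δ_comp_σ_self (i := j.succ)
      rw [← Fin.succ_castSucc] at h
      rw [h, Fin.val_succ, δ_comp_threshold_of_lt _ (by simp),
        δ_comp_threshold_of_le _ (by simp)]
      rfl
    h_castSucc_comp_δ_succ_of_lt := fun {n} i j hij => by
      have hij' : j.val < i.val := hij
      rw [Category.assoc, hδ, ← Category.assoc, ← Category.assoc, X.δ_comp_σ_of_gt hij,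
        δ_comp_threshold_of_le _ (by simp; omega)]
      rfl
    h_comp_σ_castSucc_of_le := fun {n} i j hij => by
      have hij' : i.val ≤ j.val := hij
      rw [Category.assoc, hσ, ← Category.assoc, ← Category.assoc, X.σ_comp_σ hij,
        σ_comp_threshold_of_lt _ (by simp; omega)]
      rfl
    h_comp_σ_succ_of_lt := fun {n} i j hij => by
      have hij' : j.val ≤ i.val := hij
      rw [Category.assoc, hσ, ← Category.assoc, ← Category.assoc, ← X.σ_comp_σ hij,
        σ_comp_threshold_of_le _ (by simp; omega)]
      rfl }

end Cylinder

/-! ### Recognition of Dold–Kan objects -/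

section Recognition

open AlgebraicTopology NormalizedMooreComplex

variable {K : Type u} [CommRing K] 

theorem objD_arrow (V : SimplicialObject (ModuleCat.{u} K)) (n : ℕ) :
    objD V n ≫ (objX V n).arrow = (objX V (n + 1)).arrow ≫ V.δ 0 := by
  rcases n with _ | n
  · have : IsIso (objX V 0).arrow := inferInstanceAs (IsIso (⊤ : Subobject _).arrow)
    have h : inv (objX V 0).arrow ≫ (objX V 0).arrow = 𝟙 _ := IsIso.inv_hom_id _
    change ((objX V 1).arrow ≫ V.δ 0 ≫ inv (objX V 0).arrow) ≫ (objX V 0).arrow = _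
    rw [Category.assoc, Category.assoc, h, Category.comp_id]
  · rw [objD]
    exact Subobject.factorThru_arrow _ _ _

theorem objX_arrow_δ (V : SimplicialObject (ModuleCat.{u} K)) (n : ℕ) (i : Fin (n + 1)) :
    (objX V (n + 1)).arrow ≫ V.δ i.succ = 0 := by
  rw [objX_add_one, ← Subobject.factorThru_arrow _ _
    (Subobject.finset_inf_arrow_factors Finset.univ _ i (by simp)), Category.assoc,
    kernelSubobject_arrow_comp, comp_zero]

/-- A simplicial module is the Dold–Kan object of `C` if its elements killed by all the faces
except the zeroth are identified with the elements of `C`. -/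
theorem nonempty_gamma_iso (C : ChainComplex (ModuleCat.{u} K) ℕ)
    (V : SimplicialObject (ModuleCat.{u} K))
    (φ : ∀ n, C.X n ⟶ V.obj (op (SimplexCategory.mk n)))
    (hinj : ∀ n, Function.Injective (φ n).hom) (h0 : Function.Surjective (φ 0).hom)
    (hδ : ∀ (n : ℕ) (i : Fin (n + 1)) (x : C.X (n + 1)), (V.δ i.succ).hom ((φ (n + 1)).hom x) = 0)
    (hsurj : ∀ (n : ℕ) (y : V.obj (op (SimplexCategory.mk (n + 1)))),
      (∀ i : Fin (n + 1), (V.δ i.succ).hom y = 0) → ∃ x, (φ (n + 1)).hom x = y)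
    (hd : ∀ (n : ℕ) (x : C.X (n + 1)),
      (V.δ 0).hom ((φ (n + 1)).hom x) = (φ n).hom ((C.d (n + 1) n).hom x)) :
    Nonempty (AlgebraicTopology.DoldKan.Γ₀.obj C ≅ V) := by
  have hfac : ∀ n, (objX V n).Factors (φ n) := by
    intro n
    rcases n with _ | n
    · exact Subobject.top_factors _
    · refine (Subobject.finset_inf_factors _).mpr fun i _ => kernelSubobject_factors _ _ ?_
      ext x
      exact hδ n i x
  let l : ∀ n, C.X n ⟶ (objX V n : ModuleCat.{u} K) := fun n => (objX V n).factorThru (φ n) (hfac n)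
  have hl : ∀ n, l n ≫ (objX V n).arrow = φ n := fun n => Subobject.factorThru_arrow _ _ _
  have harrow : ∀ n, Function.Injective (objX V n).arrow.hom := fun n =>
    (ModuleCat.mono_iff_injective _).1 inferInstance
  have hbij : ∀ n, Function.Bijective (l n).hom := by
    intro n
    refine ⟨fun x y h => hinj n ?_, fun y => ?_⟩
    · rw [← hl n]
      exact congrArg (objX V n).arrow.hom h
    · have h1 : ∃ x, (φ n).hom x = (objX V n).arrow.hom y := by
        rcases n with _ | n
        · exact h0 _
        · exact hsurj n _ fun i => congrArg (fun g => g.hom y) (objX_arrow_δ V n i)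
      obtain ⟨x, hx⟩ := h1
      refine ⟨x, harrow n ?_⟩
      rw [← hx, ← hl n]
      rfl
  have hiso : ∀ n, IsIso (l n) := fun n => (ConcreteCategory.isIso_iff_bijective _).2 (hbij n)
  have hcomm : ∀ n, l (n + 1) ≫ objD V n = C.d (n + 1) n ≫ l n := by
    intro n
    rw [← cancel_mono (objX V n).arrow, Category.assoc, Category.assoc, objD_arrow, hl,
      ← Category.assoc, hl]
    ext x
    exact hd n x
  let e : C ≅ Abelian.DoldKan.N.obj V :=
    HomologicalComplex.Hom.isoOfComponents (fun n => @asIso _ _ _ _ (l n) (hiso n)) (by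
      rintro i j hij
      obtain rfl : j + 1 = i := hij
      change l (j + 1) ≫ ((normalizedMooreComplex _).obj V).d (j + 1) j = C.d (j + 1) j ≫ l j
      rw [normalizedMooreComplex_objD]
      exact hcomm j)
  -- The hypotheses describe an isomorphism from `C` to the Moore complex of `V`; the Dold–Kan
  -- equivalence transports it to simplicial modules.
  exact ⟨Abelian.DoldKan.Γ.mapIso e ≪≫ (Abelian.DoldKan.equivalence.unitIso.app V).symm⟩

end Recognition

/-! ### An explicit model of the Dold–Kan objects -/

section Model

variable {K : Type u} [CommRing K]

/-- The chain maps from the normalized chains of a simplex to `C`. -/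
def gammaObj (C : ChainComplex (ModuleCat.{u} K) ℕ) (Δ : SimplexCategory) :
    Submodule K (∀ m : ℕ, (SimplexCategory.mk m ⟶ Δ) → C.X m) where
  carrier := {f | (∀ (m : ℕ) (i : Fin (m + 1)) (v : SimplexCategory.mk m ⟶ Δ),
      f (m + 1) (SimplexCategory.σ i ≫ v) = 0) ∧
    ∀ (m : ℕ) (v : SimplexCategory.mk (m + 1) ⟶ Δ), (C.d (m + 1) m).hom (f (m + 1) v) =
      ∑ i : Fin (m + 2), (-1 : ℤ) ^ (i : ℕ) • f m (SimplexCategory.δ i ≫ v)}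
  add_mem' {f g} hf hg := by
    refine ⟨fun m i v => ?_, fun m v => ?_⟩
    · simp [hf.1, hg.1]
    · simp [hf.2, hg.2, Finset.sum_add_distrib]
  zero_mem' := by
    refine ⟨fun m i v => rfl, fun m v => ?_⟩
    simp
  smul_mem' c f hf := by
    refine ⟨fun m i v => ?_, fun m v => ?_⟩
    · simp [hf.1]
    · simp only [Pi.smul_apply, map_smul, hf.2, Finset.smul_sum]
      exact Finset.sum_congr rfl fun i _ => smul_comm _ _ _

/-- The endomorphism `σ_k` followed by `δ_k` moves only the vertex `k`, which it sends to `k + 1`,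
and `v` does not distinguish these two. -/
theorem exists_σ_comp {m : ℕ} {Δ : SimplexCategory} (v : SimplexCategory.mk (m + 1) ⟶ Δ)
    (k : Fin (m + 1)) (hk : v.toOrderHom k.castSucc = v.toOrderHom k.succ) :
    v = SimplexCategory.σ k ≫ SimplexCategory.δ k.castSucc ≫ v := by
  ext j : 3
  change v.toOrderHom j = v.toOrderHom (k.castSucc.succAbove (k.predAbove j))
  by_cases h : j = k.castSucc
  · subst h
    rw [Fin.predAbove_castSucc_self, Fin.succAbove_castSucc_self, hk]
  · rw [Fin.succAbove_predAbove h]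

/-- The faces `k` and `k + 1` of a simplex degenerate along `σ_k` agree and have opposite signs; all
its other faces are degenerate. -/
theorem alternating_sum_degenerate {C : ChainComplex (ModuleCat.{u} K) ℕ} {Δ : SimplexCategory}
    (f : ∀ m : ℕ, (SimplexCategory.mk m ⟶ Δ) → C.X m)
    (hf : ∀ (m : ℕ) (i : Fin (m + 1)) (v : SimplexCategory.mk m ⟶ Δ),
      f (m + 1) (SimplexCategory.σ i ≫ v) = 0) {m : ℕ} (k : Fin (m + 1))
    (v : SimplexCategory.mk m ⟶ Δ) :
    ∑ i : Fin (m + 2), (-1 : ℤ) ^ (i : ℕ) •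
      f m (SimplexCategory.δ i ≫ SimplexCategory.σ k ≫ v) = 0 := by
  refine (Submodule.mem_bot K).1 (alternating_sum_mem ⊥ _ k ?_ fun l h1 h2 => ?_)
  · rw [SimplexCategory.δ_comp_σ_self_assoc, SimplexCategory.δ_comp_σ_succ_assoc]
  · rw [Submodule.mem_bot]
    obtain ⟨m, rfl, ⟨l, k, rfl, rfl, h⟩ | ⟨l, k, rfl, rfl, h⟩⟩ := fin_cases_of_ne h1 h2
    · have h' := SimplexCategory.δ_comp_σ_of_le_assoc h v
      exact (congrArg (f (m + 1)) h').trans (hf _ _ _)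
    · have h' := SimplexCategory.δ_comp_σ_of_gt_assoc h v
      exact (congrArg (f (m + 1)) h').trans (hf _ _ _)

/-- On degenerate simplices both sides of the chain map condition vanish, so only the nondegenerate
ones need to be checked. -/
theorem mem_gammaObj_of_strictMono {C : ChainComplex (ModuleCat.{u} K) ℕ} {Δ : SimplexCategory}
    (f : ∀ m : ℕ, (SimplexCategory.mk m ⟶ Δ) → C.X m)
    (hf : ∀ (m : ℕ) (i : Fin (m + 1)) (v : SimplexCategory.mk m ⟶ Δ),
      f (m + 1) (SimplexCategory.σ i ≫ v) = 0)
    (hd : ∀ (m : ℕ) (v : SimplexCategory.mk (m + 1) ⟶ Δ), StrictMono v.toOrderHom →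
      (C.d (m + 1) m).hom (f (m + 1) v) =
        ∑ i : Fin (m + 2), (-1 : ℤ) ^ (i : ℕ) • f m (SimplexCategory.δ i ≫ v)) :
    f ∈ gammaObj C Δ := by
  refine ⟨hf, fun m v => ?_⟩
  by_cases hv : StrictMono v.toOrderHom
  · exact hd m v hv
  · rw [Fin.strictMono_iff_lt_succ] at hv
    push Not at hv
    obtain ⟨k, hk⟩ := hv
    have hk' := le_antisymm (v.toOrderHom.monotone (Fin.castSucc_lt_succ (i := k)).le) hk
    rw [exists_σ_comp v k hk', hf, alternating_sum_degenerate f hf, map_zero]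

/-- The simplicial module of chain maps from the normalized chains of the simplices to `C`. -/
def gammaModel (C : ChainComplex (ModuleCat.{u} K) ℕ) : SimplicialObject (ModuleCat.{u} K) where
  obj Δ := ModuleCat.of K (gammaObj C Δ.unop)
  map θ := ModuleCat.ofHom (LinearMap.restrict
    { toFun := fun f m v => f m (v ≫ θ.unop)
      map_add' := fun _ _ => rfl
      map_smul' := fun _ _ => rfl }
    (fun f hf => ⟨fun m i v => by simpa using hf.1 m i (v ≫ θ.unop),
      fun m v => by simpa using hf.2 m (v ≫ θ.unop)⟩))
  map_id Δ := by
    refine ModuleCat.hom_ext (LinearMap.ext fun f => Subtype.ext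
      (funext fun m => funext fun v => ?_))
    exact congrArg (f.1 m) (Category.comp_id v)
  map_comp θ η := by
    refine ModuleCat.hom_ext (LinearMap.ext fun f => Subtype.ext
      (funext fun m => funext fun v => ?_))
    exact congrArg (f.1 m) (Category.assoc v η.unop θ.unop).symm

/-- The functoriality of the model in the chain complex. -/
def gammaModelMap {C D : ChainComplex (ModuleCat.{u} K) ℕ} (a : C ⟶ D) :
    gammaModel C ⟶ gammaModel D where
  app Δ := ModuleCat.ofHom (LinearMap.restrict
    { toFun := fun f m v => (a.f m).hom (f m v)
      map_add' := fun f g => by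
        funext m v
        exact map_add _ _ _
      map_smul' := fun c f => by
        funext m v
        exact map_smul _ _ _ }
    (fun f hf => ⟨fun m i v => by
        change (a.f (m + 1)).hom (f (m + 1) (SimplexCategory.σ i ≫ v)) = 0
        rw [hf.1, map_zero], fun m v => by
        change (D.d (m + 1) m).hom ((a.f (m + 1)).hom (f (m + 1) v)) =
          ∑ i : Fin (m + 2), (-1 : ℤ) ^ (i : ℕ) • (a.f m).hom (f m (SimplexCategory.δ i ≫ v))
        have h := congrArg (fun g => g.hom (f (m + 1) v)) (a.comm (m + 1) m)
        refine h.trans ?_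
        change (a.f m).hom ((C.d (m + 1) m).hom (f (m + 1) v)) = _
        rw [hf.2, map_sum]
        exact Finset.sum_congr rfl fun i _ => map_zsmul _ _ _⟩))
  naturality Δ Δ' θ := rfl

/-- The final face of dimension `m` of the `n`-simplex. -/
def IsFinal (n m : ℕ) (v : SimplexCategory.mk m ⟶ SimplexCategory.mk n) : Prop :=
  ∀ j : Fin (m + 1), (v.toOrderHom j).val + m = n + j.val

theorem not_isFinal_σ {n m : ℕ} (i : Fin (m + 1)) (v : SimplexCategory.mk m ⟶ SimplexCategory.mk n) :
    ¬ IsFinal n (m + 1) (SimplexCategory.σ i ≫ v) := by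
  intro h
  have h1 := h i.castSucc
  have h2 := h i.succ
  have e1 : (SimplexCategory.σ i ≫ v).toOrderHom i.castSucc = v.toOrderHom i :=
    congrArg v.toOrderHom (Fin.predAbove_castSucc_self i)
  have e2 : (SimplexCategory.σ i ≫ v).toOrderHom i.succ = v.toOrderHom i :=
    congrArg v.toOrderHom (Fin.predAbove_succ_self i)
  rw [e1] at h1
  rw [e2] at h2
  simp at h1 h2
  omega

theorem isFinal_id (n : ℕ) : IsFinal n n (𝟙 _) := fun j => by
  change j.val + n = _
  omega

theorem isFinal_δ_zero (n : ℕ) : IsFinal (n + 1) n (SimplexCategory.δ 0) := fun j => by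
  change (Fin.succAbove 0 j).val + n = _
  simp
  omega

theorem IsFinal.eq_id {n : ℕ} {v : SimplexCategory.mk n ⟶ SimplexCategory.mk n}
    (h : IsFinal n n v) : v = 𝟙 _ := by
  ext j : 3
  have := h j
  apply Fin.ext
  change (v.toOrderHom j).val = j.val
  omega

theorem IsFinal.eq_δ_zero {n : ℕ} {v : SimplexCategory.mk n ⟶ SimplexCategory.mk (n + 1)}
    (h : IsFinal (n + 1) n v) : v = SimplexCategory.δ 0 := by
  ext j : 3
  have := h j
  have h2 := isFinal_δ_zero n j
  apply Fin.ext
  omega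

open Classical in
/-- The simplex of the model with a given value at the nondegenerate top simplex, and vanishing
on all its faces except the zeroth. -/
def gammaTop (C : ChainComplex (ModuleCat.{u} K) ℕ) (n : ℕ) (x : C.X n) (m : ℕ)
    (v : SimplexCategory.mk m ⟶ SimplexCategory.mk n) : C.X m :=
  -- The intended values are `x` on the top simplex and `dx` on its zeroth face. One formula covers
  -- both: `C.d n m` is zero unless `n = m + 1`, and the first summand is zero unless `n = m`.
  if IsFinal n m v then
    (if h : n = m then (C.XIsoOfEq h).hom.hom x else 0) + (C.d n m).hom x else 0

theorem gammaTop_id (C : ChainComplex (ModuleCat.{u} K) ℕ) (n : ℕ) (x : C.X n) :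
    gammaTop C n x n (𝟙 _) = x := by
  rw [gammaTop, if_pos (isFinal_id n), dif_pos rfl, C.shape n n (by simp)]
  simp [HomologicalComplex.XIsoOfEq]

theorem gammaTop_δ_zero (C : ChainComplex (ModuleCat.{u} K) ℕ) (n : ℕ) (x : C.X (n + 1)) :
    gammaTop C (n + 1) x n (SimplexCategory.δ 0) = (C.d (n + 1) n).hom x := by
  rw [gammaTop, if_pos (isFinal_δ_zero n), dif_neg (by omega), zero_add]

theorem gammaTop_of_not_isFinal (C : ChainComplex (ModuleCat.{u} K) ℕ) (n : ℕ) (x : C.X n) (m : ℕ)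
    (v : SimplexCategory.mk m ⟶ SimplexCategory.mk n) (hv : ¬ IsFinal n m v) :
    gammaTop C n x m v = 0 := if_neg hv

theorem gammaTop_of_lt (C : ChainComplex (ModuleCat.{u} K) ℕ) (n : ℕ) (x : C.X n) (m : ℕ)
    (v : SimplexCategory.mk m ⟶ SimplexCategory.mk n) (hm : m + 1 < n) :
    gammaTop C n x m v = 0 := by
  rw [gammaTop, dif_neg (by omega), C.shape n m (by simp; omega)]
  simp

theorem gammaTop_comp_δ_succ (C : ChainComplex (ModuleCat.{u} K) ℕ) (n : ℕ) (x : C.X (n + 1))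
    (m : ℕ) (i : Fin (n + 1)) (v : SimplexCategory.mk m ⟶ SimplexCategory.mk n) :
    gammaTop C (n + 1) x m (v ≫ SimplexCategory.δ i.succ) = 0 := by
  rcases lt_or_ge m n with hlt | hle
  · exact gammaTop_of_lt _ _ _ _ _ (by omega)
  · refine gammaTop_of_not_isFinal _ _ _ _ _ fun h => ?_
    have hi := i.isLt
    -- At this index a final simplex of dimension `m` would take the value `i + 1`, the vertex
    -- omitted by `δ i.succ`. The subtraction does not truncate, since `n ≤ m`.
    obtain ⟨j, hj⟩ : ∃ j : Fin (m + 1), j.val = i.val + m - n := ⟨⟨i.val + m - n, by omega⟩, rfl⟩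
    refine Fin.succAbove_ne i.succ (v.toOrderHom j) (Fin.ext ?_)
    have h2 : ((v ≫ SimplexCategory.δ i.succ).toOrderHom j).val + m = n + 1 + j.val := h j
    change ((v ≫ SimplexCategory.δ i.succ).toOrderHom j).val = i.val + 1
    omega

theorem gammaObj_ext {C : ChainComplex (ModuleCat.{u} K) ℕ} {Δ : SimplexCategory}
    {f g : gammaObj C Δ} (h : ∀ (m : ℕ) (v : SimplexCategory.mk m ⟶ Δ), Mono v →
      f.1 m v = g.1 m v) : f = g := by
  apply Subtype.ext
  funext m v
  by_cases hv : Mono v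
  · exact h m v hv
  · rw [SimplexCategory.mono_iff_injective] at hv
    rcases m with _ | m
    · exact absurd (fun x y _ => Subsingleton.elim (α := Fin 1) x y) hv
    · obtain ⟨i, v', rfl⟩ := SimplexCategory.eq_σ_comp_of_not_injective v hv
      rw [f.2.1, g.2.1]

theorem exists_comp_δ {n m : ℕ} (v : SimplexCategory.mk m ⟶ SimplexCategory.mk (n + 1))
    (hm : m ≤ n) : ∃ (i : Fin (n + 2)) (v' : SimplexCategory.mk m ⟶ SimplexCategory.mk n),
      v = v' ≫ SimplexCategory.δ i := by
  refine SimplexCategory.eq_comp_δ_of_not_surjective v fun h => ?_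
  have := SimplexCategory.epi_iff_surjective.2 h
  have := SimplexCategory.len_le_of_epi v
  simp at this
  omega

/-- The chain map condition at the top simplex determines the value on the zeroth face from the top
value and the other faces. A proper face of the zeroth face also lies in a face of positive index,
by the simplicial identity `δ_k ≫ δ_0 = δ_0 ≫ δ_{k+1}`. -/
theorem gammaObj_eq_zero_of_δ_succ {C : ChainComplex (ModuleCat.{u} K) ℕ} {n : ℕ}
    (f : gammaObj C (SimplexCategory.mk (n + 1)))
    (hf : ∀ (i : Fin (n + 1)) (m : ℕ) (v : SimplexCategory.mk m ⟶ SimplexCategory.mk n),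
      f.1 m (v ≫ SimplexCategory.δ i.succ) = 0)
    (h : f.1 (n + 1) (𝟙 _) = 0) : f = 0 := by
  refine gammaObj_ext fun m v hv => ?_
  change f.1 m v = 0
  have hle : m ≤ n + 1 := SimplexCategory.len_le_of_mono v
  rcases hle.eq_or_lt with rfl | hlt
  · obtain rfl := SimplexCategory.eq_id_of_mono v
    exact h
  · obtain ⟨i, v, rfl⟩ := exists_comp_δ v (by omega)
    obtain rfl | ⟨i, rfl⟩ := Fin.eq_zero_or_eq_succ i
    · have hv' : Mono v := mono_of_mono v (SimplexCategory.δ 0)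
      rcases (show m ≤ n by omega).eq_or_lt with rfl | hlt'
      · obtain rfl := SimplexCategory.eq_id_of_mono v
        have h1 := f.2.2 m (𝟙 _)
        rw [h, map_zero, Finset.sum_eq_single 0] at h1
        · rw [Category.id_comp]
          simpa using h1.symm
        · intro i _ hi
          obtain ⟨i, rfl⟩ := Fin.exists_succ_eq.2 hi
          have h2 := hf i m (𝟙 _)
          rw [Category.id_comp] at h2
          rw [Category.comp_id, h2, smul_zero]
        · simp
      · obtain ⟨n, rfl⟩ : ∃ n', n = n' + 1 := ⟨n - 1, by omega⟩
        obtain ⟨k, v, rfl⟩ := exists_comp_δ v (by omega)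
        have h2 := SimplexCategory.δ_comp_δ (Fin.zero_le k)
        rw [Fin.castSucc_zero] at h2
        rw [Category.assoc, ← h2, ← Category.assoc]
        exact hf _ _ _
    · exact hf i m v

/-- On the top simplex the boundary sum reduces to its zeroth term `dx`. In codimension one the
condition is `d d x = 0` or trivial, and below that everything vanishes for reasons of dimension. -/
theorem gammaTop_mem (C : ChainComplex (ModuleCat.{u} K) ℕ) (n : ℕ) (x : C.X n) :
    gammaTop C n x ∈ gammaObj C (SimplexCategory.mk n) := by
  refine mem_gammaObj_of_strictMono _
    (fun m i v => gammaTop_of_not_isFinal _ _ _ _ _ (not_isFinal_σ i v)) fun m v hv => ?_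
  have hmono : Mono v := SimplexCategory.mono_iff_injective.2 hv.injective
  have hle : m + 1 ≤ n := SimplexCategory.len_le_of_mono v
  rcases hle.eq_or_lt with rfl | hlt
  · obtain rfl := SimplexCategory.eq_id_of_mono v
    rw [gammaTop_id, Finset.sum_eq_single 0]
    · rw [Category.comp_id, gammaTop_δ_zero]
      simp
    · intro i _ hi
      rw [Category.comp_id, gammaTop_of_not_isFinal, smul_zero]
      intro h
      exact hi (SimplexCategory.δ_injective h.eq_δ_zero)
    · simp
  · rw [Finset.sum_eq_zero fun i _ => by rw [gammaTop_of_lt _ _ _ _ _ hlt, smul_zero]]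
    rcases (show m + 2 ≤ n from hlt).eq_or_lt with rfl | hlt'
    · by_cases h : IsFinal (m + 2) (m + 1) v
      · rw [h.eq_δ_zero, gammaTop_δ_zero]
        exact congrArg (fun g => g.hom x) (C.d_comp_d (m + 2) (m + 1) m)
      · rw [gammaTop_of_not_isFinal _ _ _ _ _ h, map_zero]
    · rw [gammaTop_of_lt _ _ _ _ _ hlt', map_zero]

/-- The model is isomorphic to the Dold–Kan object. -/
theorem nonempty_gammaModel_iso (C : ChainComplex (ModuleCat.{u} K) ℕ) :
    Nonempty (AlgebraicTopology.DoldKan.Γ₀.obj C ≅ gammaModel C) := by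
  let φ : ∀ n, C.X n ⟶ (gammaModel C).obj (op (SimplexCategory.mk n)) := fun n =>
    ModuleCat.ofHom
      { toFun := fun x => (⟨gammaTop C n x, gammaTop_mem C n x⟩ : gammaObj C _)
        map_add' := fun x y => by
          apply Subtype.ext
          funext m v
          change gammaTop C n (x + y) m v = gammaTop C n x m v + gammaTop C n y m v
          simp only [gammaTop]
          split_ifs <;> simp [add_add_add_comm]
        map_smul' := fun c x => by
          apply Subtype.ext
          funext m v
          change gammaTop C n (c • x) m v = c • gammaTop C n x m v
          simp only [gammaTop]
          split_ifs <;> simp }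
  have hφ : ∀ n x m v, ((φ n).hom x : gammaObj C _).1 m v = gammaTop C n x m v :=
    fun _ _ _ _ => rfl
  refine nonempty_gamma_iso C _ φ ?_ ?_ ?_ ?_ ?_
  · intro n x y h
    have := congrArg (fun f : gammaObj C (SimplexCategory.mk n) => f.1 n (𝟙 _)) h
    simpa only [hφ, gammaTop_id] using this
  · intro f
    refine ⟨(f : gammaObj C (SimplexCategory.mk 0)).1 0 (𝟙 _), gammaObj_ext fun m v hv => ?_⟩
    have hle : m ≤ 0 := SimplexCategory.len_le_of_mono v
    obtain rfl : m = 0 := by omega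
    obtain rfl := SimplexCategory.eq_id_of_mono v
    rw [hφ, gammaTop_id]
  · intro n i x
    exact Subtype.ext (funext fun m => funext fun v => gammaTop_comp_δ_succ C n x m i v)
  · intro n f hf
    let f' : gammaObj C (SimplexCategory.mk (n + 1)) := f
    let g' : gammaObj C (SimplexCategory.mk (n + 1)) := (φ (n + 1)).hom (f'.1 (n + 1) (𝟙 _))
    -- The preimage must be the value of `f` at the top simplex; the difference then has zero top
    -- value and vanishes on all positive faces.
    refine ⟨f'.1 (n + 1) (𝟙 _), sub_eq_zero.1 (gammaObj_eq_zero_of_δ_succ (g' - f') ?_ ?_)⟩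
    · intro i m v
      have h1 : f'.1 m (v ≫ SimplexCategory.δ i.succ) = 0 :=
        congrArg (fun g : gammaObj C (SimplexCategory.mk n) => g.1 m v) (hf i)
      change gammaTop C (n + 1) _ m (v ≫ SimplexCategory.δ i.succ) -
        f'.1 m (v ≫ SimplexCategory.δ i.succ) = 0
      rw [h1, gammaTop_comp_δ_succ, sub_zero]
    · change gammaTop C (n + 1) _ (n + 1) (𝟙 _) - f'.1 (n + 1) (𝟙 _) = 0
      rw [gammaTop_id, sub_self]
  · intro n x
    refine gammaObj_ext (C := C) (Δ := SimplexCategory.mk n) fun m v hv => ?_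
    change gammaTop C (n + 1) x m (v ≫ SimplexCategory.δ 0) =
      gammaTop C n ((C.d (n + 1) n).hom x) m v
    have hle : m ≤ n := SimplexCategory.len_le_of_mono v
    rcases hle.eq_or_lt with rfl | hlt
    · obtain rfl := SimplexCategory.eq_id_of_mono v
      rw [gammaTop_id, Category.id_comp, gammaTop_δ_zero]
    · rw [gammaTop_of_lt _ _ _ _ _ (by omega)]
      symm
      rcases (show m + 1 ≤ n from hlt).eq_or_lt with rfl | hlt'
      · by_cases h : IsFinal (m + 1) m v
        · rw [h.eq_δ_zero, gammaTop_δ_zero]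
          exact congrArg (fun g => g.hom x) (C.d_comp_d (m + 2) (m + 1) m)
        · rw [gammaTop_of_not_isFinal _ _ _ _ _ h]
      · rw [gammaTop_of_lt _ _ _ _ _ hlt']

end Model

/-! ### Homotopy invariance of the model -/

section ModelHomotopy

variable {K : Type u} [CommRing K]

/-- Chain homotopies of chain complexes indexed by the natural numbers, in components. -/
structure ChainHomotopyData {C D : ChainComplex (ModuleCat.{u} K) ℕ} (a b : C ⟶ D) where
  /-- The components. -/
  h (m : ℕ) : C.X m ⟶ D.X (m + 1)
  zero (x : C.X 0) : (D.d 1 0).hom ((h 0).hom x) = (a.f 0).hom x - (b.f 0).hom x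
  succ (m : ℕ) (x : C.X (m + 1)) : (D.d (m + 2) (m + 1)).hom ((h (m + 1)).hom x) =
    (a.f (m + 1)).hom x - (b.f (m + 1)).hom x - (h m).hom ((C.d (m + 1) m).hom x)

variable {C D : ChainComplex (ModuleCat.{u} K) ℕ} {a b : C ⟶ D} (H : ChainHomotopyData a b)

theorem castSucc_succAbove_last {n : ℕ} (k : Fin (n + 1)) :
    k.castSucc.succAbove (Fin.last n) = Fin.last (n + 1) := by
  rw [Fin.succAbove_of_le_castSucc _ _ (by
    rw [Fin.castSucc_le_castSucc_iff]
    exact Fin.le_last k), Fin.succ_last]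

section

variable {n : ℕ} (w : SimplexCategory.mk n ⟶ SimplexCategory.mk 1)

include H in
/-- The correction term of the cylinder map. -/
def cylinderCorrection (f : ∀ m : ℕ, (SimplexCategory.mk m ⟶ SimplexCategory.mk n) → C.X m) :
    ∀ m : ℕ, (SimplexCategory.mk m ⟶ SimplexCategory.mk n) → D.X m
  | 0, _ => 0
  | m + 1, v =>
    if (v ≫ w).toOrderHom (Fin.last m).castSucc = 0 ∧ (v ≫ w).toOrderHom (Fin.last (m + 1)) = 1
    then (-1 : ℤ) ^ (m + 1) • (H.h m).hom (f m (SimplexCategory.δ (Fin.last (m + 1)) ≫ v)) else 0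

variable (a b) in
/-- The main term of the cylinder map. -/
def cylinderMain (f : ∀ m : ℕ, (SimplexCategory.mk m ⟶ SimplexCategory.mk n) → C.X m) (m : ℕ)
    (v : SimplexCategory.mk m ⟶ SimplexCategory.mk n) : D.X m :=
  if (v ≫ w).toOrderHom (Fin.last m) = 0 then (a.f m).hom (f m v) else (b.f m).hom (f m v)

theorem δ_comp_apply {m : ℕ} {Δ : SimplexCategory} (i : Fin (m + 2))
    (v : SimplexCategory.mk (m + 1) ⟶ Δ) (j : Fin (m + 1)) :
    (SimplexCategory.δ i ≫ v).toOrderHom j = v.toOrderHom (i.succAbove j) := rfl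

theorem σ_comp_apply {m : ℕ} {Δ : SimplexCategory} (i : Fin (m + 1))
    (v : SimplexCategory.mk m ⟶ Δ) (j : Fin (m + 2)) :
    (SimplexCategory.σ i ≫ v).toOrderHom j = v.toOrderHom (i.predAbove j) := rfl

/-- If `σ_i` repeats the last vertex there is no jump from `0` to `1` at the end. Otherwise the
front face is degenerate too and `f` vanishes on it. -/
theorem cylinderCorrection_σ {f : ∀ m : ℕ, (SimplexCategory.mk m ⟶ SimplexCategory.mk n) → C.X m}
    (hf : f ∈ gammaObj C (SimplexCategory.mk n)) (m : ℕ) (i : Fin (m + 1))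
    (v : SimplexCategory.mk m ⟶ SimplexCategory.mk n) :
    cylinderCorrection H w f (m + 1) (SimplexCategory.σ i ≫ v) = 0 := by
  rw [cylinderCorrection]
  split_ifs with h
  · obtain ⟨h1, h2⟩ := h
    obtain ⟨i, rfl⟩ | rfl := Fin.eq_castSucc_or_eq_last i
    · rcases m with _ | m
      · exact i.elim0
      · have h3 := SimplexCategory.δ_comp_σ_of_gt_assoc (j := i) (i := Fin.last (m + 1))
          (Fin.castSucc_lt_last i) v
        rw [Fin.succ_last] at h3
        rw [h3, hf.1, map_zero, smul_zero]
    · rw [Category.assoc, σ_comp_apply, Fin.predAbove_castSucc_self] at h1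
      rw [Category.assoc, σ_comp_apply, ← Fin.succ_last, Fin.predAbove_succ_self, h1] at h2
      exact absurd h2 (by decide)
  · rfl

theorem monotone_comp {m : ℕ} (v : SimplexCategory.mk m ⟶ SimplexCategory.mk n)
    {i j : Fin (m + 1)} (hij : i ≤ j) (h : (v ≫ w).toOrderHom j = 0) :
    (v ≫ w).toOrderHom i = 0 := by
  have h1 := (v ≫ w).toOrderHom.monotone hij
  rw [h] at h1
  exact le_antisymm h1 (Fin.zero_le _)

theorem ne_zero_iff_eq_one (x : Fin 2) : x ≠ 0 ↔ x = 1 := by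
  revert x
  decide

theorem sum_cylinderCorrection_of_eq_zero
    (f : ∀ m : ℕ, (SimplexCategory.mk m ⟶ SimplexCategory.mk n) → C.X m) (m : ℕ)
    (v : SimplexCategory.mk (m + 1) ⟶ SimplexCategory.mk n)
    (hv : (v ≫ w).toOrderHom (Fin.last (m + 1)) = 0) :
    ∑ i : Fin (m + 2), (-1 : ℤ) ^ (i : ℕ) •
      cylinderCorrection H w f m (SimplexCategory.δ i ≫ v) = 0 := by
  refine Finset.sum_eq_zero fun i _ => ?_
  rcases m with _ | m
  · exact smul_zero _
  · rw [cylinderCorrection, if_neg, smul_zero]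
    rintro ⟨-, h⟩
    rw [Category.assoc, δ_comp_apply, monotone_comp w v (Fin.le_last _) hv] at h
    exact absurd h (by decide)

/-- Only the two faces that omit one of the last two vertices can end with a jump. Their front faces
coincide and their signs are opposite. -/
theorem sum_cylinderCorrection_of_eq_one
    (f : ∀ m : ℕ, (SimplexCategory.mk m ⟶ SimplexCategory.mk n) → C.X m) (m : ℕ)
    (v : SimplexCategory.mk (m + 1) ⟶ SimplexCategory.mk n)
    (hv : (v ≫ w).toOrderHom (Fin.last m).castSucc = 1) :
    ∑ i : Fin (m + 2), (-1 : ℤ) ^ (i : ℕ) •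
      cylinderCorrection H w f m (SimplexCategory.δ i ≫ v) = 0 := by
  rcases m with _ | m
  · exact Finset.sum_eq_zero fun i _ => smul_zero _
  · have hv' : (v ≫ w).toOrderHom (Fin.last (m + 2)) = 1 := by
      rw [← ne_zero_iff_eq_one]
      intro h
      rw [monotone_comp w v (Fin.le_last _) h] at hv
      exact absurd hv (by decide)
    rw [Fin.sum_univ_castSucc, Fin.sum_univ_castSucc, Finset.sum_eq_zero, zero_add]
    · have h1 : SimplexCategory.δ (Fin.last (m + 1)) ≫ SimplexCategory.δ (Fin.last (m + 2)) ≫ v =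
          SimplexCategory.δ (Fin.last (m + 1)) ≫
            SimplexCategory.δ (Fin.last (m + 1)).castSucc ≫ v := by
        have := SimplexCategory.δ_comp_δ_self (n := m) (i := Fin.last (m + 1))
        rw [Fin.succ_last] at this
        rw [← Category.assoc, ← Category.assoc, this]
      rw [cylinderCorrection, cylinderCorrection, h1]
      simp only [Category.assoc, δ_comp_apply, Fin.succAbove_last, castSucc_succAbove_last,
        hv, hv']
      have h2 : (Fin.last (m + 1)).castSucc.succAbove (Fin.last m).castSucc =
          (Fin.last m).castSucc.castSucc := by
        rw [Fin.succAbove_castSucc_of_lt _ _ (Fin.castSucc_lt_last _)]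
      rw [h2, Fin.val_castSucc, Fin.val_last, Fin.val_last, pow_succ (-1 : ℤ) (m + 1), mul_neg_one,
        neg_smul, add_neg_cancel]
    · intro i _
      rw [cylinderCorrection, if_neg, smul_zero]
      rintro ⟨h, -⟩
      have h2 : i.castSucc.castSucc.succAbove (Fin.last m).castSucc =
          (Fin.last (m + 1)).castSucc := by
        rw [Fin.succAbove_of_le_castSucc _ _ (by
          rw [Fin.castSucc_le_castSucc_iff, Fin.castSucc_le_castSucc_iff]
          exact Fin.le_last i)]
        rfl
      rw [Category.assoc, δ_comp_apply, h2, hv] at h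
      exact absurd h (by decide)

/-- Omitting the last vertex destroys the jump, while every other face keeps it. The remaining terms
sum, up to sign, to `h` of the differential of the front face, which the homotopy relation rewrites.
In dimension zero there are no corrections and the relation is `d h = a - b`. -/
theorem sum_cylinderCorrection_of_jump
    {f : ∀ m : ℕ, (SimplexCategory.mk m ⟶ SimplexCategory.mk n) → C.X m}
    (hf : f ∈ gammaObj C (SimplexCategory.mk n)) (m : ℕ)
    (v : SimplexCategory.mk (m + 1) ⟶ SimplexCategory.mk n)
    (hv : (v ≫ w).toOrderHom (Fin.last m).castSucc = 0)
    (hv' : (v ≫ w).toOrderHom (Fin.last (m + 1)) = 1) :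
    ∑ i : Fin (m + 2), (-1 : ℤ) ^ (i : ℕ) •
        cylinderCorrection H w f m (SimplexCategory.δ i ≫ v) =
      (-1 : ℤ) ^ m • ((a.f m).hom (f m (SimplexCategory.δ (Fin.last (m + 1)) ≫ v)) -
        (b.f m).hom (f m (SimplexCategory.δ (Fin.last (m + 1)) ≫ v)) -
        (D.d (m + 1) m).hom
          ((H.h m).hom (f m (SimplexCategory.δ (Fin.last (m + 1)) ≫ v)))) := by
  rcases m with _ | m
  · refine (Finset.sum_eq_zero fun i _ => smul_zero _).trans ?_
    rw [H.zero, sub_self, smul_zero]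
  · rw [H.succ, sub_sub_cancel, hf.2, map_sum, Fin.sum_univ_castSucc, Finset.smul_sum]
    have h0 : cylinderCorrection H w f (m + 1) (SimplexCategory.δ (Fin.last (m + 2)) ≫ v) = 0 := by
      rw [cylinderCorrection, if_neg]
      rintro ⟨-, h⟩
      rw [Category.assoc, δ_comp_apply, Fin.succAbove_last, hv] at h
      exact absurd h (by decide)
    rw [h0, smul_zero, add_zero]
    refine Finset.sum_congr rfl fun k _ => ?_
    have h3 := SimplexCategory.δ_comp_δ (i := k) (j := Fin.last (m + 1)) (Fin.le_last _)
    rw [Fin.succ_last] at h3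
    rw [cylinderCorrection, if_pos, map_zsmul, ← Category.assoc, ← Category.assoc, h3,
      smul_comm, Fin.val_castSucc]
    rw [Category.assoc, δ_comp_apply, δ_comp_apply, castSucc_succAbove_last]
    refine ⟨monotone_comp w v ?_ hv, hv'⟩
    by_contra h
    have h4 := Fin.succAbove_ne k.castSucc (Fin.last m).castSucc
    have h5 : (k.castSucc.succAbove (Fin.last m).castSucc).val ≤ m + 1 := by
      rcases lt_or_ge (Fin.last m).castSucc.castSucc k.castSucc with h' | h'
      · rw [Fin.succAbove_of_castSucc_lt _ _ h']
        simp
      · rw [Fin.succAbove_of_le_castSucc _ _ h']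
        simp
    exact h h5

/-- The formula is the Alexander–Whitney map for `(v, v ≫ w)`. A front face of `v` is paired with
the last vertex of `v ≫ w`, which selects `a` or `b`, or with its last edge, which contributes `± h`
when it is the nondegenerate edge of the interval. The three cases are: all vertices over `0`, a
jump exactly at the last edge, and the last edge over `1`. -/
theorem cylinder_mem {f : ∀ m : ℕ, (SimplexCategory.mk m ⟶ SimplexCategory.mk n) → C.X m}
    (hf : f ∈ gammaObj C (SimplexCategory.mk n)) :
    (fun m v => cylinderMain a b w f m v + cylinderCorrection H w f m v) ∈
      gammaObj D (SimplexCategory.mk n) := by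
  refine ⟨fun m i v => ?_, fun m v => ?_⟩
  · change cylinderMain a b w f (m + 1) _ + cylinderCorrection H w f (m + 1) _ = 0
    rw [cylinderCorrection_σ H w hf, cylinderMain, hf.1, map_zero, map_zero, ite_self, add_zero]
  · have ha : (D.d (m + 1) m).hom ((a.f (m + 1)).hom (f (m + 1) v)) =
        ∑ i : Fin (m + 2), (-1 : ℤ) ^ (i : ℕ) • (a.f m).hom (f m (SimplexCategory.δ i ≫ v)) := by
      refine (congrArg (fun g => g.hom (f (m + 1) v)) (a.comm (m + 1) m)).trans ?_
      change (a.f m).hom ((C.d (m + 1) m).hom (f (m + 1) v)) = _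
      rw [hf.2, map_sum]
      exact Finset.sum_congr rfl fun i _ => map_zsmul _ _ _
    have hb : (D.d (m + 1) m).hom ((b.f (m + 1)).hom (f (m + 1) v)) =
        ∑ i : Fin (m + 2), (-1 : ℤ) ^ (i : ℕ) • (b.f m).hom (f m (SimplexCategory.δ i ≫ v)) := by
      refine (congrArg (fun g => g.hom (f (m + 1) v)) (b.comm (m + 1) m)).trans ?_
      change (b.f m).hom ((C.d (m + 1) m).hom (f (m + 1) v)) = _
      rw [hf.2, map_sum]
      exact Finset.sum_congr rfl fun i _ => map_zsmul _ _ _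
    simp only [smul_add, Finset.sum_add_distrib, map_add]
    by_cases h1 : (v ≫ w).toOrderHom (Fin.last (m + 1)) = 0
    · rw [sum_cylinderCorrection_of_eq_zero H w f m v h1, add_zero, cylinderMain, if_pos h1, ha,
        cylinderCorrection, if_neg (by rw [h1]; simp), map_zero, add_zero]
      refine Finset.sum_congr rfl fun i _ => ?_
      rw [cylinderMain, if_pos]
      rw [Category.assoc, δ_comp_apply]
      exact monotone_comp w v (Fin.le_last _) h1
    · have h1' := (ne_zero_iff_eq_one _).1 h1
      rw [cylinderMain, if_neg h1, hb]
      have hmain : ∀ k : Fin (m + 1), cylinderMain a b w f m (SimplexCategory.δ k.castSucc ≫ v) =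
          (b.f m).hom (f m (SimplexCategory.δ k.castSucc ≫ v)) := by
        intro k
        rw [cylinderMain, if_neg]
        rw [Category.assoc, δ_comp_apply, castSucc_succAbove_last]
        exact h1
      by_cases h2 : (v ≫ w).toOrderHom (Fin.last m).castSucc = 0
      -- Only the face omitting the last vertex carries `a` instead of `b`; the term `a - b` in the
      -- sum of the corrections makes up for this.
      · rw [sum_cylinderCorrection_of_jump H w hf m v h2 h1', cylinderCorrection,
          if_pos ⟨h2, h1'⟩, Fin.sum_univ_castSucc,
          Fin.sum_univ_castSucc (f := fun i => (-1 : ℤ) ^ (i : ℕ) • cylinderMain a b w f m _)]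
        simp only [hmain]
        rw [cylinderMain, if_pos (by
          rw [Category.assoc, δ_comp_apply, Fin.succAbove_last]
          exact h2), map_zsmul, Fin.val_last, pow_succ, mul_neg_one, neg_smul, neg_smul, neg_smul,
          smul_sub, smul_sub]
        abel
      · have h2' := (ne_zero_iff_eq_one _).1 h2
        rw [sum_cylinderCorrection_of_eq_one H w f m v h2', cylinderCorrection,
          if_neg (fun h => h2 h.1), map_zero]
        congr 1
        rw [Fin.sum_univ_castSucc,
          Fin.sum_univ_castSucc (f := fun i => (-1 : ℤ) ^ (i : ℕ) • cylinderMain a b w f m _)]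
        simp only [hmain]
        rw [cylinderMain, if_neg]
        rw [Category.assoc, δ_comp_apply, Fin.succAbove_last]
        exact h2

/-- The map of the model attached to a simplex of the interval by a chain homotopy. -/
def cylinderMap : (gammaModel C).obj (op (SimplexCategory.mk n)) ⟶
    (gammaModel D).obj (op (SimplexCategory.mk n)) :=
  ModuleCat.ofHom (LinearMap.restrict
    { toFun := fun f m v => cylinderMain a b w f m v + cylinderCorrection H w f m v
      map_add' := fun f g => by
        funext m v
        have h1 : cylinderMain a b w (f + g) m v =
            cylinderMain a b w f m v + cylinderMain a b w g m v := by
          simp only [cylinderMain, Pi.add_apply, map_add]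
          split_ifs <;> rfl
        have h2 : cylinderCorrection H w (f + g) m v =
            cylinderCorrection H w f m v + cylinderCorrection H w g m v := by
          rcases m with _ | m
          · exact (add_zero _).symm
          · simp only [cylinderCorrection, Pi.add_apply, map_add]
            split_ifs
            · exact smul_add _ _ _
            · exact (add_zero _).symm
        simp only [Pi.add_apply, h1, h2]
        abel
      map_smul' := fun c f => by
        funext m v
        have h1 : cylinderMain a b w (c • f) m v = c • cylinderMain a b w f m v := by
          simp only [cylinderMain, Pi.smul_apply, map_smul]
          split_ifs <;> rfl
        have h2 : cylinderCorrection H w (c • f) m v = c • cylinderCorrection H w f m v := by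
          rcases m with _ | m
          · exact (smul_zero _).symm
          · simp only [cylinderCorrection, Pi.smul_apply, map_smul]
            split_ifs
            · exact smul_comm _ _ _
            · exact (smul_zero _).symm
        simp only [Pi.smul_apply, h1, h2, RingHom.id_apply, smul_add] }
    (fun _ hf => cylinder_mem H w hf))

/-- The cylinder terms involve `w` only through `v ≫ w`, which is what naturality in the simplex
requires. -/
theorem cylinderMain_comp {m : ℕ} (θ : SimplexCategory.mk m ⟶ SimplexCategory.mk n)
    (w : SimplexCategory.mk n ⟶ SimplexCategory.mk 1)
    (f : ∀ m : ℕ, (SimplexCategory.mk m ⟶ SimplexCategory.mk n) → C.X m) (k : ℕ)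
    (v : SimplexCategory.mk k ⟶ SimplexCategory.mk m) :
    cylinderMain a b w f k (v ≫ θ) = cylinderMain a b (θ ≫ w) (fun k v => f k (v ≫ θ)) k v := by
  simp only [cylinderMain, Category.assoc]

theorem cylinderCorrection_comp {m : ℕ} (θ : SimplexCategory.mk m ⟶ SimplexCategory.mk n)
    (w : SimplexCategory.mk n ⟶ SimplexCategory.mk 1)
    (f : ∀ m : ℕ, (SimplexCategory.mk m ⟶ SimplexCategory.mk n) → C.X m) (k : ℕ)
    (v : SimplexCategory.mk k ⟶ SimplexCategory.mk m) :
    cylinderCorrection H w f k (v ≫ θ) =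
      cylinderCorrection H (θ ≫ w) (fun k v => f k (v ≫ θ)) k v := by
  rcases k with _ | k
  · rfl
  · simp only [cylinderCorrection, Category.assoc]

end

/-- A chain homotopy induces a simplicial homotopy of the models. -/
def gammaModelHomotopy : SimplicialObject.Homotopy (gammaModelMap a) (gammaModelMap b) :=
  homotopyOfCylinder (fun w => cylinderMap H w)
    (fun {n m} θ w => by
      refine ModuleCat.hom_ext (LinearMap.ext fun f => Subtype.ext
        (funext fun k => funext fun v => ?_))
      exact congrArg₂ (· + ·) (cylinderMain_comp θ w _ k v) (cylinderCorrection_comp H θ w _ k v))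
    (fun n => by
      refine ModuleCat.hom_ext (LinearMap.ext fun f => Subtype.ext
        (funext fun k => funext fun v => ?_))
      have h0 : ∀ j, (v ≫ threshold n (n + 1)).toOrderHom j = 0 := fun j =>
        if_pos (v.toOrderHom j).isLt
      change cylinderMain a b _ _ k v + cylinderCorrection H _ _ k v = (a.f k).hom _
      rw [cylinderMain, if_pos (h0 _)]
      rcases k with _ | k
      · exact add_zero _
      · rw [cylinderCorrection, if_neg, add_zero]
        rintro ⟨-, h⟩
        rw [h0] at h
        exact absurd h (by decide))
    (fun n => by
      refine ModuleCat.hom_ext (LinearMap.ext fun f => Subtype.ext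
        (funext fun k => funext fun v => ?_))
      have h1 : ∀ j, (v ≫ threshold n 0).toOrderHom j ≠ 0 := fun j => by
        have h : (v ≫ threshold n 0).toOrderHom j =
            (if (v.toOrderHom j).val < 0 then (0 : Fin 2) else 1) := rfl
        rw [h, if_neg (Nat.not_lt_zero _)]
        simp
      change cylinderMain a b _ _ k v + cylinderCorrection H _ _ k v = (b.f k).hom _
      rw [cylinderMain, if_neg (h1 _)]
      rcases k with _ | k
      · exact add_zero _
      · rw [cylinderCorrection, if_neg (fun h => h1 _ h.1), add_zero])

end ModelHomotopy

/-! ### Dold–Puppe derived functors of free modules -/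

section DoldPuppeFree

open AlgebraicTopology

open scoped ZeroObject

variable {K : Type u} [CommRing K]

theorem gammaModelMap_id (C : ChainComplex (ModuleCat.{u} K) ℕ) :
    gammaModelMap (𝟙 C) = 𝟙 (gammaModel C) := rfl

theorem gammaModelMap_comp {C D E : ChainComplex (ModuleCat.{u} K) ℕ} (a : C ⟶ D) (b : D ⟶ E) :
    gammaModelMap (a ≫ b) = gammaModelMap a ≫ gammaModelMap b := rfl

/-- The homology of the simplicial module `F(V)`, computed by its alternating face map complex. -/
abbrev simplicialHomology (F : ModuleCat.{u} K ⥤ ModuleCat.{u} K) (n : ℕ) :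
    SimplicialObject (ModuleCat.{u} K) ⥤ ModuleCat.{u} K :=
  (SimplicialObject.whiskering _ _).obj F ⋙ alternatingFaceMapComplex _ ⋙
    HomologicalComplex.homologyFunctor _ _ n

/-- A simplicial homotopy consists of maps and compositional identities, so unlike a chain homotopy
it is preserved by a functor that is not additive. -/
theorem simplicialHomology_map_gammaModelMap (F : ModuleCat.{u} K ⥤ ModuleCat.{u} K) (n : ℕ)
    {C D : ChainComplex (ModuleCat.{u} K) ℕ} {a b : C ⟶ D} (H : ChainHomotopyData a b) :
    (simplicialHomology F n).map (gammaModelMap a) =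
      (simplicialHomology F n).map (gammaModelMap b) :=
  ((gammaModelHomotopy H).whiskerRight F).map_homology_eq n

/-- The homotopy invariance of the homology of `F(V)`. -/
def simplicialHomologyIso (F : ModuleCat.{u} K ⥤ ModuleCat.{u} K) (n : ℕ)
    {C D : ChainComplex (ModuleCat.{u} K) ℕ} (a : C ⟶ D) (b : D ⟶ C)
    (H : ChainHomotopyData (a ≫ b) (𝟙 C)) (H' : ChainHomotopyData (b ≫ a) (𝟙 D)) :
    (simplicialHomology F n).obj (gammaModel C) ≅ (simplicialHomology F n).obj (gammaModel D) where
  hom := (simplicialHomology F n).map (gammaModelMap a)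
  inv := (simplicialHomology F n).map (gammaModelMap b)
  hom_inv_id := by
    rw [← Functor.map_comp, ← gammaModelMap_comp, simplicialHomology_map_gammaModelMap F n H,
      gammaModelMap_id, CategoryTheory.Functor.map_id]
  inv_hom_id := by
    rw [← Functor.map_comp, ← gammaModelMap_comp, simplicialHomology_map_gammaModelMap F n H',
      gammaModelMap_id, CategoryTheory.Functor.map_id]

/-- The functoriality of the shift. -/
def shiftOneMap {C D : ChainComplex (ModuleCat.{u} K) ℕ} (a : C ⟶ D) : shiftOne C ⟶ shiftOne D where
  f
    | 0 => 𝟙 _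
    | n + 1 => a.f n
  comm' i j hij := by
    obtain rfl : j + 1 = i := hij
    rcases j with _ | j
    · exact (isZero_zero _).eq_of_tgt _ _
    · exact a.comm (j + 1) j

/-- The shift of a chain homotopy. -/
def shiftOneHomotopy {C D : ChainComplex (ModuleCat.{u} K) ℕ} {a b : C ⟶ D} (H : Homotopy a b) :
    ChainHomotopyData (shiftOneMap a) (shiftOneMap b) where
  h
    | 0 => (0 : (0 : ModuleCat.{u} K) ⟶ D.X 0)
    | n + 1 => H.hom n (n + 1)
  zero x := by
    have := ModuleCat.subsingleton_of_isZero (isZero_zero (ModuleCat.{u} K))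
    exact Subsingleton.elim (α := (0 : ModuleCat.{u} K)) _ _
  succ m x := by
    rcases m with _ | m
    · have h := H.comm 0
      rw [dNext_eq_zero _ _ (by simp), prevD_eq _ (show (ComplexShape.down ℕ).Rel 1 0 by simp),
        zero_add] at h
      have h' : (a.f 0).hom x = (D.d 1 0).hom ((H.hom 0 1).hom x) + (b.f 0).hom x :=
        congrArg (fun g => g.hom x) h
      change (D.d 1 0).hom ((H.hom 0 1).hom x) = (a.f 0).hom x - (b.f 0).hom x - 0
      rw [h']
      abel
    · have h := H.comm (m + 1)
      rw [dNext_eq _ (show (ComplexShape.down ℕ).Rel (m + 1) m by simp),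
        prevD_eq _ (show (ComplexShape.down ℕ).Rel (m + 2) (m + 1) by simp)] at h
      have h' : (a.f (m + 1)).hom x = (H.hom m (m + 1)).hom ((C.d (m + 1) m).hom x) +
          (D.d (m + 2) (m + 1)).hom ((H.hom (m + 1) (m + 2)).hom x) + (b.f (m + 1)).hom x :=
        congrArg (fun g => g.hom x) h
      change (D.d (m + 2) (m + 1)).hom ((H.hom (m + 1) (m + 2)).hom x) =
        (a.f (m + 1)).hom x - (b.f (m + 1)).hom x - (H.hom m (m + 1)).hom ((C.d (m + 1) m).hom x)
      rw [h']
      abel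

/-- The shift of a module in degree zero. -/
def shiftOneSingleIso (B : ModuleCat.{u} K) :
    shiftOne ((ChainComplex.single₀ (ModuleCat.{u} K)).obj B) ≅
      (HomologicalComplex.single (ModuleCat.{u} K) (ComplexShape.down ℕ) 1).obj B :=
  HomologicalComplex.Hom.isoOfComponents
    (fun
      | 0 => (isZero_zero _).iso (HomologicalComplex.isZero_single_obj_X (ComplexShape.down ℕ) 1 B 0 (by simp))
      | 1 => HomologicalComplex.singleObjXSelf (ComplexShape.down ℕ) 0 B ≪≫
          (HomologicalComplex.singleObjXSelf (ComplexShape.down ℕ) 1 B).symm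
      | n + 2 => (HomologicalComplex.isZero_single_obj_X (ComplexShape.down ℕ) 0 B (n + 1) (by simp)).iso
          (HomologicalComplex.isZero_single_obj_X (ComplexShape.down ℕ) 1 B (n + 2) (by simp)))
    (by
      rintro i j hij
      obtain rfl : j + 1 = i := hij
      rcases j with _ | j
      · apply IsZero.eq_of_tgt
        exact HomologicalComplex.isZero_single_obj_X (ComplexShape.down ℕ) 1 B 0 (by simp)
      · apply IsZero.eq_of_src
        exact HomologicalComplex.isZero_single_obj_X (ComplexShape.down ℕ) 0 B (j + 1) (by simp))

/-- The homotopy invariance of the homology of `F(V)` under chain homotopy equivalences of Dold–Kan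
objects. -/
theorem nonempty_doldPuppe_iso (F : ModuleCat.{u} K ⥤ ModuleCat.{u} K) (B : ModuleCat.{u} K)
    [Projective B] (i : ℕ) : Nonempty (doldPuppe F B 1 i ≅
      (simplicialHomology F i).obj (eilenbergMacLane B 1)) := by
  let P := projectiveResolution B
  -- Since `B` is projective, `B` in degree 0 is itself a projective resolution, unique up to
  -- homotopy equivalence.
  let e := ProjectiveResolution.homotopyEquiv P (ProjectiveResolution.self B)
  obtain ⟨e₁⟩ := nonempty_gammaModel_iso (shiftOne P.complex)
  obtain ⟨e₂⟩ := nonempty_gammaModel_iso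
    (shiftOne ((ChainComplex.single₀ (ModuleCat.{u} K)).obj B))
  have hid : ∀ C : ChainComplex (ModuleCat.{u} K) ℕ, shiftOneMap (𝟙 C) = 𝟙 (shiftOne C) := by
    intro C
    ext n : 1
    cases n <;> rfl
  have hcomp : ∀ {C D E : ChainComplex (ModuleCat.{u} K) ℕ} (a : C ⟶ D) (b : D ⟶ E),
      shiftOneMap (a ≫ b) = shiftOneMap a ≫ shiftOneMap b := by
    intro C D E a b
    ext n : 1
    cases n
    · exact (Category.comp_id _).symm
    · rfl
  have H := shiftOneHomotopy e.homotopyHomInvId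
  have H' := shiftOneHomotopy e.homotopyInvHomId
  rw [hid, hcomp] at H H'
  exact ⟨(normalizedHomologyIso (applySimplicial F (DoldKan.Γ₀.obj (shiftOne P.complex))) i).symm ≪≫
    (simplicialHomology F i).mapIso e₁ ≪≫ simplicialHomologyIso F i _ _ H H' ≪≫
    (simplicialHomology F i).mapIso
      (e₂.symm ≪≫ DoldKan.Γ₀.mapIso (shiftOneSingleIso B))⟩

end DoldPuppeFree

/-! ### Duals of simplicial and cosimplicial modules -/

section DualObjects

open AlgebraicTopology

variable {K : Type u} [CommRing K]

/-- The simplicial module dual to a cosimplicial module. -/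
def dualSimplicial (W : CosimplicialObject (ModuleCat.{u} K)) :
    SimplicialObject (ModuleCat.{u} K) where
  obj Δ := dualMod (W.obj Δ.unop)
  map θ := dualMap (W.map θ.unop)
  map_id Δ := by
    rw [unop_id, W.map_id]
    rfl
  map_comp θ η := by
    rw [unop_comp, W.map_comp]
    rfl

/-- The cosimplicial module dual to a simplicial module. -/
def dualCosimplicial (V : SimplicialObject (ModuleCat.{u} K)) :
    CosimplicialObject (ModuleCat.{u} K) where
  obj Δ := dualMod (V.obj (op Δ))
  map θ := dualMap (V.map θ.op)
  map_id Δ := by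
    rw [op_id, V.map_id]
    rfl
  map_comp θ η := by
    rw [op_comp, V.map_comp]
    rfl

theorem dualMap_comp {M N P : ModuleCat.{u} K} (f : M ⟶ N) (g : N ⟶ P) :
    dualMap (f ≫ g) = dualMap g ≫ dualMap f := rfl

/-- The transpose of an isomorphism. -/
def dualIso {M N : ModuleCat.{u} K} (e : M ≅ N) : dualMod M ≅ dualMod N where
  hom := dualMap e.inv
  inv := dualMap e.hom
  hom_inv_id := by
    rw [← dualMap_comp, e.hom_inv_id]
    rfl
  inv_hom_id := by
    rw [← dualMap_comp, e.inv_hom_id]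
    rfl

/-- The dual cosimplicial modules of isomorphic simplicial modules are isomorphic. -/
def dualCosimplicialIso {V V' : SimplicialObject (ModuleCat.{u} K)} (e : V ≅ V') :
    dualCosimplicial V ≅ dualCosimplicial V' :=
  NatIso.ofComponents (fun Δ => dualIso (e.app (op Δ))) (fun θ => by
    change dualMap (V.map θ.op) ≫ dualMap (e.inv.app _) =
      dualMap (e.inv.app _) ≫ dualMap (V'.map θ.op)
    rw [← dualMap_comp, ← dualMap_comp, e.inv.naturality])

theorem map_mem_conormalized {W W' : CosimplicialObject (ModuleCat.{u} K)} (f : W ⟶ W') (n : ℕ) :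
    ∀ x ∈ conormalized W n, (((alternatingCofaceMapComplex _).map f).f n).hom x ∈
      conormalized W' n := by
  intro x hx
  rcases n with _ | n
  · trivial
  · refine (Submodule.mem_iInf _).2 fun i => ?_
    have h := congrArg (fun g => g.hom x) (f.naturality (SimplexCategory.σ i))
    exact h.symm.trans ((congrArg (f.app (SimplexCategory.mk n)).hom
      ((Submodule.mem_iInf _).1 hx i)).trans (map_zero (f.app (SimplexCategory.mk n)).hom))

/-- The functoriality of the normalized cochain complex. -/
def normalizedCochainMap {W W' : CosimplicialObject (ModuleCat.{u} K)} (f : W ⟶ W') :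
    normalizedCochain W ⟶ normalizedCochain W' where
  f n := ModuleCat.ofHom ((((alternatingCofaceMapComplex _).map f).f n).hom.restrict
    (map_mem_conormalized f n))
  comm' i j _ := by
    ext x
    exact Subtype.ext (congrArg (fun g => g.hom x.1)
      (((alternatingCofaceMapComplex _).map f).comm i j))

/-- The invariance of the normalized cochain complex under isomorphisms. -/
def normalizedCochainIso {W W' : CosimplicialObject (ModuleCat.{u} K)} (e : W ≅ W') :
    normalizedCochain W ≅ normalizedCochain W' where
  hom := normalizedCochainMap e.hom
  inv := normalizedCochainMap e.inv
  hom_inv_id := by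
    ext n x
    exact Subtype.ext (congrArg (fun g => g.hom x.1) (e.hom_inv_id_app (SimplexCategory.mk n)))
  inv_hom_id := by
    ext n x
    exact Subtype.ext (congrArg (fun g => g.hom x.1) (e.inv_hom_id_app (SimplexCategory.mk n)))

theorem dualMap_alternating_sum {M N : ModuleCat.{u} K} {n : ℕ} (f : Fin n → (M ⟶ N)) :
    dualMap (∑ l : Fin n, (-1 : ℤ) ^ (l : ℕ) • f l) =
      ∑ l : Fin n, (-1 : ℤ) ^ (l : ℕ) • dualMap (f l) := by
  refine ModuleCat.hom_ext (LinearMap.ext fun φ => LinearMap.ext fun x => ?_)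
  rw [ModuleCat.hom_sum, LinearMap.sum_apply, LinearMap.sum_apply]
  change φ ((∑ l : Fin n, (-1 : ℤ) ^ (l : ℕ) • f l).hom x) = _
  rw [ModuleCat.hom_sum, LinearMap.sum_apply, map_sum]
  exact Finset.sum_congr rfl fun l _ => map_zsmul φ ((-1 : ℤ) ^ (l : ℕ)) ((f l).hom x)

theorem dualCosimplicial_d (V : SimplicialObject (ModuleCat.{u} K)) (n : ℕ) :
    ((alternatingCofaceMapComplex _).obj (dualCosimplicial V)).d n (n + 1) =
      dualMap (((alternatingFaceMapComplex _).obj V).d (n + 1) n) := by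
  have h1 : ((alternatingCofaceMapComplex _).obj (dualCosimplicial V)).d n (n + 1) =
      ∑ l : Fin (n + 2), (-1 : ℤ) ^ (l : ℕ) • (dualCosimplicial V).δ l :=
    CochainComplex.of_d (fun n => (dualCosimplicial V).obj (SimplexCategory.mk n))
        (AlternatingCofaceMapComplex.objD (dualCosimplicial V)) n
  have h2 : ((alternatingFaceMapComplex _).obj V).d (n + 1) n =
      ∑ l : Fin (n + 2), (-1 : ℤ) ^ (l : ℕ) • V.δ l :=
    AlternatingFaceMapComplex.obj_d_eq V n
  rw [h1, h2]
  exact (dualMap_alternating_sum _).symm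

/-- The codegeneracies of the dual are the transposes of the degeneracies, so their joint kernel is
the annihilator of the degenerate part. -/
theorem mem_conormalized_dual (V : SimplicialObject (ModuleCat.{u} K)) (n : ℕ)
    (φ : Module.Dual K (((alternatingFaceMapComplex _).obj V).X n)) :
    (show ((alternatingCofaceMapComplex _).obj (dualCosimplicial V)).X n from φ) ∈
      conormalized (dualCosimplicial V) n ↔ degenerate V n ≤ LinearMap.ker φ := by
  rcases n with _ | n
  · exact iff_of_true trivial bot_le
  · refine (Submodule.mem_iInf _).trans (Iff.trans (forall_congr' fun i => ?_) iSup_le_iff.symm)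
    rw [LinearMap.range_le_ker_iff]
    rfl

/-- The dual of the normalized chain complex is the normalized cochain complex of the dual. -/
theorem nonempty_dualComplex_iso (V : SimplicialObject (ModuleCat.{u} K)) :
    Nonempty (normalizedCochain (dualCosimplicial V) ≅ dualComplex (normalizedChain V)) := by
  let t : ∀ n, Module.Dual K (((alternatingFaceMapComplex _).obj V).X n ⧸ degenerate V n) →ₗ[K]
      conormalized (dualCosimplicial V) n := fun n =>
    (degenerate V n).mkQ.dualMap.codRestrict (conormalized (dualCosimplicial V) n) (fun φ => by
      refine (mem_conormalized_dual V n _).2 fun x hx => ?_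
      change φ (Submodule.Quotient.mk x) = 0
      rw [(Submodule.Quotient.mk_eq_zero _).2 hx, map_zero])
  have ht : ∀ n, Function.Bijective (t n) := by
    refine fun n => ⟨fun φ ψ h => LinearMap.dualMap_injective_of_surjective
      (Submodule.mkQ_surjective _) (congrArg Subtype.val h), fun φ => ?_⟩
    exact ⟨(degenerate V n).liftQ φ.1 ((mem_conormalized_dual V n _).1 φ.2), rfl⟩
  exact ⟨(HomologicalComplex.Hom.isoOfComponents
    (fun n => (LinearEquiv.ofBijective (t n) (ht n)).toModuleIso) (by
      rintro i j hij
      obtain rfl : i + 1 = j := hij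
      refine ModuleCat.hom_ext (LinearMap.ext fun φ => Subtype.ext ?_)
      change (((alternatingCofaceMapComplex _).obj (dualCosimplicial V)).d i (i + 1)).hom
        (t i φ).1 = _
      rw [dualCosimplicial_d]
      rfl) : dualComplex (normalizedChain V) ≅ normalizedCochain (dualCosimplicial V)).symm⟩

/-- The evaluation map into the bidual. -/
abbrev evalMap (M : ModuleCat.{u} K) : M ⟶ dualMod (dualMod M) :=
  ModuleCat.ofHom (Module.Dual.eval K M)

theorem evalMap_naturality {M N : ModuleCat.{u} K} (f : M ⟶ N) :
    f ≫ evalMap N = evalMap M ≫ dualMap (dualMap f) := rfl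

instance isIso_evalMap (M : ModuleCat.{u} K) [Module.Free K M] [Module.Finite K M] :
    IsIso (evalMap M) :=
  (ConcreteCategory.isIso_iff_bijective _).2 (Module.bijective_dual_eval K M)

theorem map_evalMap_naturality (Φ : ModuleCat.{u} K ⥤ ModuleCat.{u} K) {M N : ModuleCat.{u} K}
    (f : M ⟶ N) : Φ.map f ≫ Φ.map (evalMap N) ≫ evalMap _ =
      (Φ.map (evalMap M) ≫ evalMap _) ≫ dualMap (dualMap (Φ.map (dualMap (dualMap f)))) := by
  have h := evalMap_naturality (Φ.map (dualMap (dualMap f)))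
  rw [← Category.assoc, ← Φ.map_comp, evalMap_naturality f, Φ.map_comp, Category.assoc,
    Category.assoc, h]

/-- The Kuhn dual of a functor recovers the functor on finitely generated free modules. -/
def kuhnDualCosimplicialIso (Φ : ModuleCat.{u} K ⥤ ModuleCat.{u} K)
    (W : CosimplicialObject (ModuleCat.{u} K)) (hW : ∀ Δ, IsIso (evalMap (W.obj Δ)))
    (hΦ : ∀ Δ, IsIso (evalMap (Φ.obj (dualMod (dualMod (W.obj Δ)))))) :
    ((CosimplicialObject.whiskering _ _).obj Φ).obj W ≅
      dualCosimplicial (applySimplicial (kuhnDual Φ) (dualSimplicial W)) :=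
  -- In each degree this is `Φ(W) ≅ Φ(W^∨∨) ≅ Φ(W^∨∨)^∨∨`, and the last module is by definition the
  -- dual of `Φ^#(W^∨)`.
  NatIso.ofComponents (fun Δ => Φ.mapIso (@asIso _ _ _ _ _ (hW Δ)) ≪≫ @asIso _ _ _ _ _ (hΦ Δ))
    (fun θ => map_evalMap_naturality Φ (W.map θ))

end DualObjects

/-! ### The cosimplicial module of relations of a free module -/

section RelationsOfFree

open AlgebraicTopology

variable {K : Type u} [CommRing K] (A : ModuleCat.{u} K) [Module.Free K A]

/-- The cosimplicial module of relations of the copowers of the identity presentation. -/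
abbrev relationsCosimplicial : CosimplicialObject (ModuleCat.{u} K) :=
  ((CosimplicialObject.whiskering _ _).obj (relations A)).obj (copowers (idPres A))

/-- The coproduct inclusions of `A` in its copowers. -/
def copowerι (Δ : SimplexCategory) (i : Fin (Δ.len + 1)) :
    A →ₗ[K] ((copowers (idPres A)).obj Δ).obj.left :=
  (Sigma.ι (fun _ : Fin (Δ.len + 1) => idPres A) i).hom.left.hom

theorem hom_copowerι (Δ : SimplexCategory) (i : Fin (Δ.len + 1)) (a : A) :
    ((copowers (idPres A)).obj Δ).obj.hom.hom (copowerι A Δ i a) = a :=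
  congrArg (fun g => g.hom a) (Over.w (Sigma.ι (fun _ : Fin (Δ.len + 1) => idPres A) i).hom)

theorem map_copowerι {Δ Δ' : SimplexCategory} (θ : Δ ⟶ Δ') (i : Fin (Δ.len + 1)) (a : A) :
    ((copowers (idPres A)).map θ).hom.left.hom (copowerι A Δ i a) =
      copowerι A Δ' (θ.toOrderHom i) a := by
  have h : Sigma.ι (fun _ : Fin (Δ.len + 1) => idPres A) i ≫ (copowers (idPres A)).map θ =
      Sigma.ι (fun _ : Fin (Δ'.len + 1) => idPres A) (θ.toOrderHom i) :=
    Sigma.ι_desc _ _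
  exact congrArg (fun g => g.hom.left.hom a) h

/-- The copowers are chosen colimits; uniqueness of colimits compares them with the explicit direct
sum and gives access to coordinates. -/
theorem exists_copower_equiv (Δ : SimplexCategory) :
    ∃ e : (Fin (Δ.len + 1) → A) ≃ₗ[K] ((copowers (idPres A)).obj Δ).obj.left,
      ∀ i a, e (Pi.single i a) = copowerι A Δ i a := by
  let p : Fin (Δ.len + 1) → Pres A := fun _ => idPres A
  let e := (coprodIsColimit p).coconePointUniqueUpToIso (colimit.isColimit (Discrete.functor p))
  let e' := (ObjectProperty.ι _ ⋙ Over.forget A).mapIso e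
  refine ⟨e'.toLinearEquiv, fun i a => ?_⟩
  have h := (coprodIsColimit p).comp_coconePointUniqueUpToIso_hom
    (colimit.isColimit (Discrete.functor p)) ⟨i⟩
  exact congrArg (fun g => g.hom.left.hom a) h

theorem exists_eq_sum_copowerι (Δ : SimplexCategory)
    (x : ((copowers (idPres A)).obj Δ).obj.left) :
    ∃ a : Fin (Δ.len + 1) → A, x = ∑ i, copowerι A Δ i (a i) := by
  obtain ⟨e, he⟩ := exists_copower_equiv A Δ
  refine ⟨e.symm x, ?_⟩
  simp only [← he, ← map_sum]
  rw [Finset.univ_sum_single, LinearEquiv.apply_symm_apply]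

/-- The relation `ι_i a - ι_0 a` in a copower of `A`. -/
def basicRelation (Δ : SimplexCategory) (i : Fin (Δ.len + 1)) :
    A →ₗ[K] (relationsCosimplicial A).obj Δ :=
  LinearMap.codRestrict (LinearMap.ker ((copowers (idPres A)).obj Δ).obj.hom.hom)
    (copowerι A Δ i - copowerι A Δ 0) (fun a => by
      rw [LinearMap.mem_ker, LinearMap.sub_apply, map_sub, hom_copowerι, hom_copowerι, sub_self])

/-- An element `∑ ι_i a_i` lies in the kernel exactly when `∑ a_i = 0`, and then subtracting `ι_0 (∑
a_i)` changes nothing. -/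
theorem exists_eq_sum_basicRelation (Δ : SimplexCategory)
    (x : (relationsCosimplicial A).obj Δ) :
    ∃ a : Fin (Δ.len + 1) → A, x = ∑ i, basicRelation A Δ i (a i) := by
  let x' : LinearMap.ker ((copowers (idPres A)).obj Δ).obj.hom.hom := x
  obtain ⟨a, ha⟩ := exists_eq_sum_copowerι A Δ x'.1
  have h0 : ∑ i, a i = 0 := by
    have h := x'.2
    rw [LinearMap.mem_ker, ha, map_sum] at h
    simpa only [hom_copowerι] using h
  refine ⟨a, ?_⟩
  refine Subtype.ext (Eq.trans ?_ (map_sum (Submodule.subtype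
    (LinearMap.ker ((copowers (idPres A)).obj Δ).obj.hom.hom)) _ _).symm)
  change x'.1 = ∑ i, (copowerι A Δ i (a i) - copowerι A Δ 0 (a i))
  rw [Finset.sum_sub_distrib, ← map_sum, h0, map_zero, sub_zero, ha]

theorem dual_relations_ext {Δ : SimplexCategory}
    {f g : Module.Dual K ((relationsCosimplicial A).obj Δ)}
    (h : ∀ i a, f (basicRelation A Δ i a) = g (basicRelation A Δ i a)) : f = g := by
  refine LinearMap.ext fun x => ?_
  obtain ⟨a, rfl⟩ := exists_eq_sum_basicRelation A _ x
  rw [map_sum, map_sum]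
  exact Finset.sum_congr rfl fun i _ => h _ _

theorem basicRelation_zero (Δ : SimplexCategory) (a : A) : basicRelation A Δ 0 a = 0 :=
  Subtype.ext (sub_self _)

/-- The summand `0` serves as base point and has to be fixed by `θ`. The cofaces of positive index
satisfy this, and the Moore complex needs no others here. -/
theorem map_basicRelation {Δ Δ' : SimplexCategory} (θ : Δ ⟶ Δ') (h0 : θ.toOrderHom 0 = 0)
    (i : Fin (Δ.len + 1)) (a : A) :
    ((relationsCosimplicial A).map θ).hom (basicRelation A Δ i a) =
      basicRelation A Δ' (θ.toOrderHom i) a := by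
  apply Subtype.ext
  change ((copowers (idPres A)).map θ).hom.left.hom (copowerι A Δ i a - copowerι A Δ 0 a) =
    copowerι A Δ' (θ.toOrderHom i) a - copowerι A Δ' 0 a
  rw [map_sub, map_copowerι, map_copowerι, h0]

theorem subsingleton_relations_zero :
    Subsingleton ((relationsCosimplicial A).obj (SimplexCategory.mk 0)) := by
  refine subsingleton_of_forall_eq 0 fun x => ?_
  obtain ⟨a, rfl⟩ := exists_eq_sum_basicRelation A _ x
  refine Finset.sum_eq_zero fun i _ => ?_
  obtain rfl : i = 0 := Subsingleton.elim (α := Fin 1) _ _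
  exact basicRelation_zero A _ _

theorem basicRelation_one_bijective :
    Function.Bijective (basicRelation A (SimplexCategory.mk 1) 1) := by
  constructor
  · intro a b h
    obtain ⟨e, he⟩ := exists_copower_equiv A (SimplexCategory.mk 1)
    have h1 : copowerι A (SimplexCategory.mk 1) 1 a - copowerι A (SimplexCategory.mk 1) 0 a =
        copowerι A (SimplexCategory.mk 1) 1 b - copowerι A (SimplexCategory.mk 1) 0 b :=
      congrArg Subtype.val h
    rw [← he, ← he, ← he, ← he, ← map_sub, ← map_sub] at h1
    have h2 := congrFun (e.injective h1) 1
    simpa using h2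
  · intro x
    obtain ⟨a, rfl⟩ := exists_eq_sum_basicRelation A _ x
    refine ⟨a 1, ?_⟩
    have := Fin.sum_univ_two (fun i => basicRelation A (SimplexCategory.mk 1) i (a i))
    exact (this.trans (by rw [basicRelation_zero, zero_add])).symm

/-- The dual of the cosimplicial module of relations is an Eilenberg–MacLane object. -/
theorem nonempty_eilenbergMacLane_iso :
    Nonempty (eilenbergMacLane (dualMod A) 1 ≅ dualSimplicial (relationsCosimplicial A)) := by
  let C := (HomologicalComplex.single (ModuleCat.{u} K) (ComplexShape.down ℕ) 1).obj (dualMod A)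
  have hC : ∀ n, n ≠ 1 → Subsingleton (C.X n) := fun n hn =>
    ModuleCat.subsingleton_of_isZero
      (HomologicalComplex.isZero_single_obj_X (ComplexShape.down ℕ) 1 _ n hn)
  have hV : Subsingleton
      ((dualSimplicial (relationsCosimplicial A)).obj (op (SimplexCategory.mk 0))) := by
    have := subsingleton_relations_zero A
    exact inferInstanceAs (Subsingleton (Module.Dual K
      ((relationsCosimplicial A).obj (SimplexCategory.mk 0))))
  let b := LinearEquiv.ofBijective _ (basicRelation_one_bijective A)
  let e₁ : C.X 1 ≅ (dualSimplicial (relationsCosimplicial A)).obj (op (SimplexCategory.mk 1)) :=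
    HomologicalComplex.singleObjXSelf (ComplexShape.down ℕ) 1 (dualMod A) ≪≫
      b.symm.dualMap.toModuleIso
  refine nonempty_gamma_iso C _ (fun
    | 0 => 0
    | 1 => e₁.hom
    | n + 2 => 0) ?_ ?_ ?_ ?_ ?_
  · intro n
    by_cases hn : n = 1
    · subst hn
      exact e₁.toLinearEquiv.injective
    · have := hC n hn
      exact Function.injective_of_subsingleton _
  · exact fun y => ⟨0, Subsingleton.elim _ _⟩
  · intro n i x
    rcases n with _ | n
    · exact Subsingleton.elim _ _
    · exact map_zero _
  · intro n y hy
    rcases n with _ | n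
    · exact ⟨e₁.inv.hom y, e₁.toLinearEquiv.apply_symm_apply y⟩
    · refine ⟨0, (map_zero _).trans (Eq.symm (dual_relations_ext A (g := 0) fun j a => ?_))⟩
      -- In simplicial degree at least two there are two or more positive cofaces, so one of them
      -- has the vertex `j` in its image. The `j`-th basic relation then comes from below, where the
      -- transposed functional vanishes.
      obtain ⟨i, hi⟩ : ∃ i : Fin (n + 2), i.succ ≠ j := by
        by_cases h : j = Fin.succ 0
        · exact ⟨1, by
            rw [h]
            exact fun h' => absurd (Fin.succ_injective _ h') (by simp)⟩
        · exact ⟨0, fun h' => h h'.symm⟩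
      obtain ⟨j', hj'⟩ := Fin.exists_succAbove_eq hi.symm
      have h := LinearMap.congr_fun (hy i) (basicRelation A (SimplexCategory.mk (n + 1)) j' a)
      have h2 := map_basicRelation A (SimplexCategory.δ i.succ) (by
        change i.succ.succAbove 0 = 0
        exact Fin.succ_succAbove_zero i) j' a
      have h3 : (SimplexCategory.δ i.succ).toOrderHom j' = j := hj'
      rw [h3] at h2
      rw [← h2]
      exact h
  · intro n x
    rcases n with _ | n
    · exact Subsingleton.elim _ _
    · have := hC (n + 2) (by omega)
      rw [Subsingleton.elim x 0]
      simp

variable [Module.Finite K A]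

theorem finite_copower (Δ : SimplexCategory) :
    Module.Finite K ((copowers (idPres A)).obj Δ).obj.left := by
  obtain ⟨e, -⟩ := exists_copower_equiv A Δ
  exact Module.Finite.equiv e

variable [IsDomain K] [IsPrincipalIdealRing K]

/-- Submodules of finitely generated free modules over a principal ideal domain are finitely
generated and free. -/
theorem finite_free_relations (Δ : SimplexCategory) :
    Module.Free K ((relationsCosimplicial A).obj Δ) ∧
      Module.Finite K ((relationsCosimplicial A).obj Δ) := by
  have := finite_copower A Δ
  have := ((copowers (idPres A)).obj Δ).property.1
  exact ⟨inferInstanceAs (Module.Free K (LinearMap.ker _)),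
    inferInstanceAs (Module.Finite K (LinearMap.ker _))⟩

/-- The cosimplicial module computing the higher limits is the dual of the simplicial module
computing the Dold–Puppe derived functors. -/
theorem nonempty_cosimplicial_iso (Φ : ModuleCat.{u} K ⥤ ModuleCat.{u} K)
    (hΦ : ∀ M : ModuleCat.{u} K, Module.Free K M → Module.Finite K M →
      Module.Free K (Φ.obj M) ∧ Module.Finite K (Φ.obj M)) :
    Nonempty (((CosimplicialObject.whiskering _ _).obj (relations A ⋙ Φ)).obj
        (copowers (idPres A)) ≅
      dualCosimplicial (applySimplicial (kuhnDual Φ) (eilenbergMacLane (dualMod A) 1))) := by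
  obtain ⟨e⟩ := nonempty_eilenbergMacLane_iso A
  refine ⟨kuhnDualCosimplicialIso Φ (relationsCosimplicial A) (fun Δ => ?_) (fun Δ => ?_) ≪≫
    dualCosimplicialIso (((SimplicialObject.whiskering _ _).obj (kuhnDual Φ)).mapIso e.symm)⟩
  · obtain ⟨_, _⟩ := finite_free_relations A Δ
    infer_instance
  · obtain ⟨_, _⟩ := finite_free_relations A Δ
    obtain ⟨_, _⟩ := hΦ (dualMod (dualMod ((relationsCosimplicial A).obj Δ)))
      inferInstance inferInstance
    infer_instance

/-- With `B` left arbitrary, the comparisons with `K(A^∨, 1)` and with `K(A, 1)` are two instances,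
`K(-, 1)` being functorial. -/
theorem nonempty_limComplex_iso (Φ : ModuleCat.{u} K ⥤ ModuleCat.{u} K)
    (hΦ : ∀ M : ModuleCat.{u} K, Module.Free K M → Module.Finite K M →
      Module.Free K (Φ.obj M) ∧ Module.Finite K (Φ.obj M)) {B : ModuleCat.{u} K}
    (e : dualMod A ≅ B) :
    Nonempty (limComplex (idPres A) (relations A ⋙ Φ) ≅
      dualComplex (normalizedChain (applySimplicial (kuhnDual Φ) (eilenbergMacLane B 1)))) := by
  obtain ⟨e₁⟩ := nonempty_cosimplicial_iso A Φ hΦ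
  let e₂ : eilenbergMacLane (dualMod A) 1 ≅ eilenbergMacLane B 1 :=
    (HomologicalComplex.single _ _ 1 ⋙ DoldKan.Γ₀).mapIso e
  obtain ⟨e₃⟩ := nonempty_dualComplex_iso (applySimplicial (kuhnDual Φ) (eilenbergMacLane B 1))
  exact ⟨normalizedCochainIso (e₁ ≪≫ dualCosimplicialIso
    (((SimplicialObject.whiskering _ _).obj (kuhnDual Φ)).mapIso e₂)) ≪≫ e₃⟩

end RelationsOfFree

/-! ### Double complexes with exact rows and columns -/

section DoubleComplex

variable {K : Type u} [CommRing K]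

/-- Two quotients of the same module with the same kernel are isomorphic. -/
theorem nonempty_equiv_of_surjective {P X Y : Type*} [AddCommGroup P] [AddCommGroup X]
    [AddCommGroup Y] [Module K P] [Module K X] [Module K Y] (f : P →ₗ[K] X) (g : P →ₗ[K] Y)
    (hf : Function.Surjective f) (hg : Function.Surjective g)
    (h : ∀ x, f x = 0 ↔ g x = 0) : Nonempty (X ≃ₗ[K] Y) :=
  ⟨(f.quotKerEquivOfSurjective hf).symm ≪≫ₗ
    Submodule.quotEquivOfEq _ _
      (show LinearMap.ker f = LinearMap.ker g from Submodule.ext h) ≪≫ₗ g.quotKerEquivOfSurjective hg⟩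

/-- The quotient of `P` by the elements of `S` in it. -/
abbrev subQuotient {M : Type*} [AddCommGroup M] [Module K M] (P S : Submodule K M) :=
  P ⧸ S.submoduleOf P

/-- If the terms and the maps of a complex are realised inside of other modules, so is its
homology. -/
theorem nonempty_midHomology_equiv_subQuotient {X₀ X₁ X₂ B₀ B₁ B₂ : Type*}
    [AddCommGroup X₀] [AddCommGroup X₁] [AddCommGroup X₂] [AddCommGroup B₀] [AddCommGroup B₁]
    [AddCommGroup B₂] [Module K X₀] [Module K X₁] [Module K X₂] [Module K B₀] [Module K B₁]
    [Module K B₂] {f : X₀ →ₗ[K] X₁} {g : X₁ →ₗ[K] X₂} {F : B₀ →ₗ[K] B₁} {G : B₁ →ₗ[K] B₂}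
    (ι₀ : X₀ →ₗ[K] B₀) (ι₁ : X₁ →ₗ[K] B₁) (ι₂ : X₂ →ₗ[K] B₂)
    (h₁ : Function.Injective ι₁) (h₂ : Function.Injective ι₂)
    (hf : ∀ x, F (ι₀ x) = ι₁ (f x)) (hg : ∀ x, G (ι₁ x) = ι₂ (g x))
    {P : Submodule K B₁} {S : Submodule K B₀} (hP : LinearMap.range ι₁ = P)
    (hS : LinearMap.range ι₀ = S) :
    Nonempty (midHomology f g ≃ₗ[K] subQuotient (P ⊓ LinearMap.ker G) (S.map F)) := by
  subst hP hS
  have hmem : ∀ x : LinearMap.ker g, ι₁ x.1 ∈ LinearMap.range ι₁ ⊓ LinearMap.ker G := fun x =>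
    ⟨⟨x.1, rfl⟩, by
      change G (ι₁ x.1) = 0
      rw [hg, show g x.1 = 0 from x.2, map_zero]⟩
  let t : LinearMap.ker g →ₗ[K] (LinearMap.range ι₁ ⊓ LinearMap.ker G : Submodule K B₁) :=
    (ι₁ ∘ₗ (LinearMap.ker g).subtype).codRestrict _ hmem
  refine nonempty_equiv_of_surjective (Submodule.mkQ _) (Submodule.mkQ _ ∘ₗ t)
    (Submodule.mkQ_surjective _) ((Submodule.mkQ_surjective _).comp ?_) fun x => ?_
  · rintro ⟨_, ⟨x, rfl⟩, hx⟩
    refine ⟨⟨x, h₂ ?_⟩, rfl⟩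
    rw [map_zero, ← hg]
    exact hx
  · rw [LinearMap.comp_apply, Submodule.mkQ_apply, Submodule.mkQ_apply,
      Submodule.Quotient.mk_eq_zero, Submodule.Quotient.mk_eq_zero]
    constructor
    · rintro ⟨y, hy⟩
      refine ⟨ι₀ y, ⟨y, rfl⟩, ?_⟩
      rw [hf, hy]
      rfl
    · rintro ⟨_, ⟨y, rfl⟩, hy⟩
      rw [hf] at hy
      exact ⟨y, h₁ hy⟩

variable {A : ℕ → ℕ → Type*} [∀ p q, AddCommGroup (A p q)] [∀ p q, Module K (A p q)]
  (h : ∀ p q, A p q →ₗ[K] A (p + 1) q) (v : ∀ p q, A p q →ₗ[K] A p (q + 1))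

/-- The cocycles in both directions modulo the horizontal images of the vertical cocycles. -/
abbrev horizontalHomology (p q : ℕ) :=
  subQuotient (LinearMap.ker (v (p + 1) q) ⊓ LinearMap.ker (h (p + 1) q))
    ((LinearMap.ker (v p q)).map (h p q))

/-- The cocycles in both directions modulo the vertical images of the horizontal cocycles. -/
abbrev verticalHomology (p q : ℕ) :=
  subQuotient (LinearMap.ker (h p (q + 1)) ⊓ LinearMap.ker (v p (q + 1)))
    ((LinearMap.ker (h p q)).map (v p q))

variable (hv : ∀ p q x, h p (q + 1) (v p q x) = v (p + 1) q (h p q x))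
  (hh : ∀ p q x, h (p + 1) q (h p q x) = 0) (vv : ∀ p q x, v p (q + 1) (v p q x) = 0)
  (exh : ∀ p q x, h (p + 1) q x = 0 → ∃ y, h p q y = x)
  (exv : ∀ p q x, v p (q + 1) x = 0 → ∃ y, v p q y = x)

include hv hh vv exh exv

/-- Both sides are quotients of `P = ker (h v) = ker (v h)`, through `v` and through `h`; exactness
gives surjectivity. The kernel is `ker h + ker v` in either case. -/
theorem nonempty_verticalHomology_equiv (p q : ℕ) :
    Nonempty (verticalHomology h v p q ≃ₗ[K] horizontalHomology h v p q) := by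
  let P : Submodule K (A p q) := LinearMap.ker (h p (q + 1) ∘ₗ v p q)
  have hP : ∀ x : P, h p (q + 1) (v p q x) = 0 := fun x => x.2
  let f : P →ₗ[K] (LinearMap.ker (h p (q + 1)) ⊓ LinearMap.ker (v p (q + 1)) : Submodule K _) :=
    (v p q ∘ₗ P.subtype).codRestrict _ fun x => ⟨hP x, vv p q x⟩
  let g : P →ₗ[K] (LinearMap.ker (v (p + 1) q) ⊓ LinearMap.ker (h (p + 1) q) : Submodule K _) :=
    (h p q ∘ₗ P.subtype).codRestrict _ fun x => ⟨(hv p q x).symm.trans (hP x), hh p q x⟩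
  refine nonempty_equiv_of_surjective (Submodule.mkQ _ ∘ₗ f) (Submodule.mkQ _ ∘ₗ g)
    ((Submodule.mkQ_surjective _).comp ?_) ((Submodule.mkQ_surjective _).comp ?_) fun x => ?_
  · rintro ⟨x, hx, hx'⟩
    obtain ⟨y, rfl⟩ := exv p q x hx'
    exact ⟨⟨y, hx⟩, rfl⟩
  · rintro ⟨x, hx, hx'⟩
    obtain ⟨y, rfl⟩ := exh p q x hx'
    exact ⟨⟨y, (hv p q y).trans hx⟩, rfl⟩
  · rw [LinearMap.comp_apply, LinearMap.comp_apply, Submodule.mkQ_apply, Submodule.mkQ_apply,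
      Submodule.Quotient.mk_eq_zero, Submodule.Quotient.mk_eq_zero]
    constructor
    · rintro ⟨y, hy, hxy : v p q y = v p q x⟩
      refine ⟨x - y, ?_, ?_⟩
      · change v p q (x - y) = 0
        rw [map_sub, hxy, sub_self]
      · change h p q (x - y) = h p q x
        rw [map_sub, show h p q y = 0 from hy, sub_zero]
    · rintro ⟨y, hy, hxy : h p q y = h p q x⟩
      refine ⟨x - y, ?_, ?_⟩
      · change h p q (x - y) = 0
        rw [map_sub, hxy, sub_self]
      · change v p q (x - y) = v p q x
        rw [map_sub, show v p q y = 0 from hy, sub_zero]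

/-- The two quotients have the same numerator, and by exactness both denominators are the image of
`h v = v h`. -/
theorem nonempty_horizontalHomology_equiv_vertical (p q : ℕ) :
    Nonempty (horizontalHomology h v p (q + 1) ≃ₗ[K] verticalHomology h v (p + 1) q) := by
  refine nonempty_equiv_of_surjective (Submodule.mkQ _)
    (Submodule.mkQ _ ∘ₗ (LinearEquiv.ofEq _ _ (inf_comm _ _)).toLinearMap)
    (Submodule.mkQ_surjective _)
    ((Submodule.mkQ_surjective _).comp (LinearEquiv.surjective _)) fun x => ?_
  rw [LinearMap.comp_apply, Submodule.mkQ_apply, Submodule.mkQ_apply,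
    Submodule.Quotient.mk_eq_zero, Submodule.Quotient.mk_eq_zero]
  constructor
  · rintro ⟨y, hy, hxy : h p (q + 1) y = x.1⟩
    obtain ⟨z, rfl⟩ := exv p q y hy
    exact ⟨h p q z, hh p q z, (hv p q z).symm.trans hxy⟩
  · rintro ⟨y, hy, hxy : v (p + 1) q y = x.1⟩
    obtain ⟨z, rfl⟩ := exh p q y hy
    exact ⟨v p q z, vv p q z, (hv p q z).trans hxy⟩

/-- In a double complex with exact rows and columns, the homologies of the two edges agree. -/
theorem nonempty_edge_equiv (n : ℕ) :
    Nonempty (verticalHomology h v 0 n ≃ₗ[K] horizontalHomology h v n 0) := by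
  -- Alternating the two preceding isomorphisms descends a staircase along the antidiagonal `p + q =
  -- n`.
  have key : ∀ q p n, p + q = n →
      Nonempty (verticalHomology h v p q ≃ₗ[K] horizontalHomology h v n 0) := by
    intro q
    induction q with
    | zero =>
      rintro p n rfl
      exact nonempty_verticalHomology_equiv h v hv hh vv exh exv p 0
    | succ q ih =>
      intro p n hn
      obtain ⟨e₁⟩ := nonempty_verticalHomology_equiv h v hv hh vv exh exv p (q + 1)
      obtain ⟨e₂⟩ := nonempty_horizontalHomology_equiv_vertical h v hv hh vv exh exv p q
      obtain ⟨e₃⟩ := ih (p + 1) n (by omega)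
      exact ⟨e₁ ≪≫ₗ e₂ ≪≫ₗ e₃⟩
  exact key n 0 n (by omega)

end DoubleComplex

/-! ### The standard complex computes the higher limits -/

section StandardComplex

variable {J : Type (u + 1)} [Category.{u} J] {K : Type u} [CommRing K]
  [∀ n : ℕ, HasCoproductsOfShape (Fin (n + 1)) J]

/-- The coproduct of `n + 1` copies of `c`. -/
abbrev copower (c : J) (n : ℕ) : J := (copowers c).obj (SimplexCategory.mk n)

/-- The inclusion of a summand of a copower. -/
abbrev copowerIncl (c : J) {n : ℕ} (i : Fin (n + 1)) : c ⟶ copower c n :=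
  Sigma.ι (fun _ : Fin ((SimplexCategory.mk n).len + 1) => c) i

theorem copower_hom_ext {c d : J} {n : ℕ} {f g : copower c n ⟶ d}
    (h : ∀ i, copowerIncl c i ≫ f = copowerIncl c i ≫ g) : f = g :=
  Sigma.hom_ext _ _ h

theorem copowerIncl_δ (c : J) {n : ℕ} (l : Fin (n + 2)) (i : Fin (n + 1)) :
    copowerIncl c i ≫ (copowers c).δ l = copowerIncl c (l.succAbove i) :=
  Sigma.ι_desc _ _

/-- The map out of a copower given by a map on the summand with index `0` and a map on the
other summands. -/
def copowerCons {c d : J} {n : ℕ} (e : c ⟶ d) (f : copower c n ⟶ d) : copower c (n + 1) ⟶ d :=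
  Sigma.desc (Fin.cases e fun j => copowerIncl c j ≫ f)

theorem copowerIncl_zero_cons {c d : J} {n : ℕ} (e : c ⟶ d) (f : copower c n ⟶ d) :
    copowerIncl c 0 ≫ copowerCons e f = e :=
  Sigma.ι_desc _ _

theorem copowerIncl_succ_cons {c d : J} {n : ℕ} (e : c ⟶ d) (f : copower c n ⟶ d)
    (i : Fin (n + 1)) : copowerIncl c i.succ ≫ copowerCons e f = copowerIncl c i ≫ f :=
  Sigma.ι_desc _ _

theorem δ_zero_cons {c d : J} {n : ℕ} (e : c ⟶ d) (f : copower c n ⟶ d) :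
    (copowers c).δ 0 ≫ copowerCons e f = f := by
  refine copower_hom_ext fun i => ?_
  rw [← Category.assoc, copowerIncl_δ, Fin.succAbove_zero, copowerIncl_succ_cons]

theorem δ_succ_cons {c d : J} {n : ℕ} (e : c ⟶ d) (f : copower c (n + 1) ⟶ d)
    (l : Fin (n + 2)) :
    (copowers c).δ l.succ ≫ copowerCons e f = copowerCons e ((copowers c).δ l ≫ f) := by
  refine copower_hom_ext fun i => ?_
  rw [← Category.assoc, copowerIncl_δ]
  cases i using Fin.cases with
  | zero => rw [Fin.succ_succAbove_zero, copowerIncl_zero_cons, copowerIncl_zero_cons]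
  | succ i => rw [Fin.succ_succAbove_succ, copowerIncl_succ_cons, copowerIncl_succ_cons,
      ← Category.assoc, copowerIncl_δ]

/-- The alternating sum of the coface maps of `F(c^•)`. -/
def cofaceSum (c : J) (F : J ⥤ ModuleCat.{w} K) (n : ℕ) :
    F.obj (copower c n) →ₗ[K] F.obj (copower c (n + 1)) :=
  ∑ l : Fin (n + 2), (-1 : ℤ) ^ (l : ℕ) • (F.map ((copowers c).δ l)).hom

theorem cofaceSum_apply (c : J) (F : J ⥤ ModuleCat.{w} K) (n : ℕ) (x : F.obj (copower c n)) :
    cofaceSum c F n x =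
      ∑ l : Fin (n + 2), (-1 : ℤ) ^ (l : ℕ) • (F.map ((copowers c).δ l)).hom x := by
  rw [cofaceSum, LinearMap.sum_apply]
  rfl

theorem cofaceSum_eq (c : J) (F : J ⥤ ModuleCat.{w} K) (n : ℕ) :
    (((AlgebraicTopology.alternatingCofaceMapComplex _).obj
      (((CosimplicialObject.whiskering _ _).obj F).obj (copowers c))).d n (n + 1)).hom =
      cofaceSum c F n := by
  refine (congrArg ModuleCat.Hom.hom (CochainComplex.of_d
    (fun n => (((CosimplicialObject.whiskering _ _).obj F).obj (copowers c)).obj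
      (SimplexCategory.mk n)) (AlgebraicTopology.AlternatingCofaceMapComplex.objD _) n)).trans ?_
  exact ModuleCat.hom_sum _ _

theorem cofaceSum_comp (c : J) (F : J ⥤ ModuleCat.{w} K) (n : ℕ) (x : F.obj (copower c n)) :
    cofaceSum c F (n + 1) (cofaceSum c F n x) = 0 := by
  rw [← cofaceSum_eq, ← cofaceSum_eq]
  exact congrArg (fun g => g.hom x) (((AlgebraicTopology.alternatingCofaceMapComplex _).obj
    (((CosimplicialObject.whiskering _ _).obj F).obj (copowers c))).d_comp_d n (n + 1) (n + 2))

theorem cofaceSum_naturality (c : J) {F G : J ⥤ ModuleCat.{w} K} (α : F ⟶ G) (n : ℕ)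
    (x : F.obj (copower c n)) :
    cofaceSum c G n ((α.app _).hom x) = (α.app _).hom (cofaceSum c F n x) := by
  rw [cofaceSum_apply, cofaceSum_apply, map_sum]
  refine Finset.sum_congr rfl fun l _ => ?_
  rw [map_zsmul]
  exact congrArg _ (congrArg (fun g => g.hom x) (α.naturality ((copowers c).δ l))).symm

/-- The functor coinduced from the values of `F`. -/
def coinduced (F : J ⥤ ModuleCat.{u + 1} K) : J ⥤ ModuleCat.{u + 1} K where
  obj x := ModuleCat.of K (∀ d : J, (x ⟶ d) → F.obj d)
  map g := ModuleCat.ofHom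
    { toFun φ d f := φ d (g ≫ f)
      map_add' _ _ := rfl
      map_smul' _ _ := rfl }
  map_id x := by
    refine ModuleCat.hom_ext (LinearMap.ext fun φ => funext fun d => funext fun f => ?_)
    exact congrArg (φ d) (Category.id_comp f)
  map_comp g g' := by
    refine ModuleCat.hom_ext (LinearMap.ext fun φ => funext fun d => funext fun f => ?_)
    exact congrArg (φ d) (Category.assoc g g' f)

/-- The embedding of a functor into the coinduced one. -/
def coinducedUnit (F : J ⥤ ModuleCat.{u + 1} K) : F ⟶ coinduced F where
  app x := ModuleCat.ofHom (LinearMap.pi fun _ => LinearMap.pi fun f => (F.map f).hom)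
  naturality x y g := by
    refine ModuleCat.hom_ext (LinearMap.ext fun v => funext fun d => funext fun f => ?_)
    exact (congrArg (fun k => k.hom v) (F.map_comp g f)).symm

instance mono_coinducedUnit (F : J ⥤ ModuleCat.{u + 1} K) : Mono (coinducedUnit F) := by
  have : ∀ x, Mono ((coinducedUnit F).app x) := fun x => by
    refine (ModuleCat.mono_iff_injective _).2 fun v w h => ?_
    have h' : (F.map (𝟙 x)).hom v = (F.map (𝟙 x)).hom w := congrFun (congrFun h x) (𝟙 x)
    simpa using h'
  exact NatTrans.mono_of_mono_app _

/-- In the factor indexed by `d`, a cochain is a function on tuples of maps `c ⟶ d`, so the complex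
is that of a full simplex on a nonempty vertex set. Prepending the vertex `e d` contracts it, and no
naturality of `e` in `d` is needed. -/
theorem coinduced_exact (c : J) (e : ∀ d, c ⟶ d) (F : J ⥤ ModuleCat.{u + 1} K) (n : ℕ)
    (φ : (coinduced F).obj (copower c (n + 1))) (h : cofaceSum c (coinduced F) (n + 1) φ = 0) :
    ∃ ψ, cofaceSum c (coinduced F) n ψ = φ := by
  have key : ∀ (m : ℕ) (ψ : ∀ d : J, (copower c m ⟶ d) → F.obj d) (d : J)
      (g : copower c (m + 1) ⟶ d),
      (cofaceSum c (coinduced F) m ψ : ∀ d : J, (copower c (m + 1) ⟶ d) → F.obj d) d g =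
        ∑ l : Fin (m + 2), (-1 : ℤ) ^ (l : ℕ) • ψ d ((copowers c).δ l ≫ g) := by
    intro m ψ d g
    let ev : (coinduced F).obj (copower c (m + 1)) →ₗ[K] F.obj d :=
      { toFun φ := (φ : ∀ d : J, (copower c (m + 1) ⟶ d) → F.obj d) d g
        map_add' _ _ := rfl
        map_smul' _ _ := rfl }
    refine (congrArg ev (cofaceSum_apply c (coinduced F) m ψ)).trans ?_
    rw [map_sum]
    exact Finset.sum_congr rfl fun l _ => map_zsmul ev _ _
  let φ' : ∀ d : J, (copower c (n + 1) ⟶ d) → F.obj d := φ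
  refine ⟨fun d f => φ' d (copowerCons (e d) f), ?_⟩
  funext d g
  refine (key n _ d g).trans ?_
  -- In the cocycle identity at the extended tuple, the zeroth face returns `φ` at `g`; the other
  -- faces give minus the coboundary of the candidate.
  have h' := (key (n + 1) φ d (copowerCons (e d) g)).symm.trans
    (congrFun (congrFun h d) (copowerCons (e d) g))
  rw [Fin.sum_univ_succ] at h'
  simp only [δ_zero_cons, δ_succ_cons, Fin.val_zero, pow_zero, one_smul, Fin.val_succ, pow_succ,
    mul_neg, mul_one, neg_smul, Finset.sum_neg_distrib] at h'
  exact (add_neg_eq_zero.1 h').symm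

/-- Injectivity makes `I` a retract of its coinduced functor. A cocycle is pushed there, bounded,
and the bounding cochain is retracted back. -/
theorem injective_exact (c : J) (e : ∀ d, c ⟶ d) (I : J ⥤ ModuleCat.{u + 1} K) [Injective I]
    (n : ℕ) (x : I.obj (copower c (n + 1))) (h : cofaceSum c I (n + 1) x = 0) :
    ∃ y, cofaceSum c I n y = x := by
  let r := Injective.factorThru (𝟙 I) (coinducedUnit I)
  obtain ⟨y, hy⟩ := coinduced_exact c e I n (((coinducedUnit I).app _).hom x) (by
    rw [cofaceSum_naturality, h, map_zero])
  refine ⟨(r.app _).hom y, ?_⟩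
  rw [cofaceSum_naturality, hy]
  exact congrArg (fun t => (t.app _).hom x) (Injective.comp_factorThru (𝟙 I) (coinducedUnit I))

/-- The two cofaces form the universal pair of maps out of `c`: any `f` and `g` into `d` factor
through them by a single map from the coproduct of two copies. -/
theorem cofaceSum_zero_eq_zero_iff (c : J) (F : J ⥤ ModuleCat.{w} K) (x : F.obj (copower c 0)) :
    cofaceSum c F 0 x = 0 ↔ ∀ (d : J) (f g : copower c 0 ⟶ d),
      (F.map f).hom x = (F.map g).hom x := by
  have hsum : cofaceSum c F 0 x = (F.map ((copowers c).δ (0 : Fin 2))).hom x -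
      (F.map ((copowers c).δ (1 : Fin 2))).hom x := by
    rw [cofaceSum_apply, Fin.sum_univ_two]
    simp [sub_eq_add_neg]
  rw [hsum, sub_eq_zero]
  refine ⟨fun h d f g => ?_, fun h => h _ _ _⟩
  let k := copowerCons (copowerIncl c 0 ≫ g) f
  have h0 : (copowers c).δ (0 : Fin 2) ≫ k = f := δ_zero_cons _ _
  have h1 : (copowers c).δ (1 : Fin 2) ≫ k = g := by
    refine copower_hom_ext fun i => ?_
    obtain rfl : i = 0 := Fin.fin_one_eq_zero i
    rw [← Category.assoc, copowerIncl_δ]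
    exact copowerIncl_zero_cons _ _
  rw [← h0, ← h1, F.map_comp, F.map_comp]
  exact congrArg (F.map k).hom h

/-- The projection of the limit to the value at the zeroth copower. -/
abbrev limitProj (c : J) (F : J ⥤ ModuleCat.{u + 1} K) :
    (limit F : ModuleCat.{u + 1} K) →ₗ[K] F.obj (copower c 0) :=
  (limit.π F (copower c 0)).hom

theorem limitProj_injective (c : J) (e : ∀ d, c ⟶ d) (F : J ⥤ ModuleCat.{u + 1} K) :
    Function.Injective (limitProj c F) := by
  refine (ModuleCat.mono_iff_injective (limit.π F (copower c 0))).1 ⟨fun f g h => ?_⟩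
  refine limit.hom_ext fun d => ?_
  have k : copower c 0 ⟶ d := Sigma.desc fun _ => e d
  rw [← limit.w F k, ← Category.assoc, h, Category.assoc]

/-- An element on which all parallel maps agree has a well-defined image at each `d`, computed along
any map from `c`, and these images form a compatible family. -/
theorem range_limitProj (c : J) (e : ∀ d, c ⟶ d) (F : J ⥤ ModuleCat.{u + 1} K) :
    LinearMap.range (limitProj c F) = LinearMap.ker (cofaceSum c F 0) := by
  let e' : ∀ d, copower c 0 ⟶ d := fun d => Sigma.desc fun _ => e d
  apply le_antisymm
  · rintro _ ⟨x, rfl⟩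
    refine (cofaceSum_zero_eq_zero_iff c F _).2 fun d f g => ?_
    exact congrArg (fun t => t.hom x) ((limit.w F f).trans (limit.w F g).symm)
  · intro x hx
    let s : Cone F :=
      { pt := ModuleCat.of K (LinearMap.ker (cofaceSum c F 0))
        π :=
          { app d := ModuleCat.ofHom ((F.map (e' d)).hom ∘ₗ Submodule.subtype _)
            naturality d d' g := by
              ext y
              refine ((cofaceSum_zero_eq_zero_iff c F y.1).1 y.2 d' (e' d') (e' d ≫ g)).trans ?_
              exact congrArg (fun t => t.hom y.1) (F.map_comp (e' d) g) } }
    refine ⟨(limit.lift F s).hom ⟨x, hx⟩, ?_⟩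
    refine (congrArg (fun t => t.hom ⟨x, hx⟩) (limit.lift_π s (copower c 0))).trans ?_
    refine ((cofaceSum_zero_eq_zero_iff c F x).1 hx _ (e' _) (𝟙 _)).trans ?_
    rw [F.map_id]
    rfl

end StandardComplex

/-! ### Comparison of the derived functors of the limit with the standard complex -/

section HigherLimitsOfStandardComplex

variable {J : Type (u + 1)} [Category.{u} J] {K : Type u} [CommRing K]

instance hasLimitsOfSize_module :
    HasLimitsOfSize.{u + 1, u + 1} (ModuleCat.{u + 1} K) :=
  ModuleCat.hasLimitsOfSize.{u + 1, u + 1, u + 1, u}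

theorem exists_of_exact {F₁ F₂ F₃ : J ⥤ ModuleCat.{u + 1} K} {f : F₁ ⟶ F₂} {g : F₂ ⟶ F₃}
    (w : f ≫ g = 0) (h : (ShortComplex.mk f g w).Exact) (x : J) (y : F₂.obj x)
    (hy : (g.app x).hom y = 0) : ∃ z, (f.app x).hom z = y :=
  (ShortComplex.moduleCat_exact_iff _).1 (h.map ((evaluation J (ModuleCat.{u + 1} K)).obj x)) y hy

variable [∀ n : ℕ, HasCoproductsOfShape (Fin (n + 1)) J]

/-- The right derived functors of the limit functor are computed by the standard complex of a
weakly initial object. -/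
theorem nonempty_rightDerived_succ_equiv (c : J) (e : ∀ d, c ⟶ d) (G : J ⥤ ModuleCat.{u + 1} K)
    (n : ℕ) :
    Nonempty (((lim : (J ⥤ ModuleCat.{u + 1} K) ⥤ ModuleCat.{u + 1} K).rightDerived
      (n + 1)).obj G ≃ₗ[K] midHomology (cofaceSum c G n) (cofaceSum c G (n + 1))) := by
  let I : InjectiveResolution G := injectiveResolution G
  have hI : ∀ q, Injective (I.cocomplex.X q) := I.injective
  -- In the double complex `I^q(c^p)`, rows are standard complexes of injectives and columns are
  -- values of the injective resolution.
  let h : ∀ p q, (I.cocomplex.X q).obj (copower c p) →ₗ[K]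
    (I.cocomplex.X q).obj (copower c (p + 1)) := fun p q => cofaceSum c (I.cocomplex.X q) p
  let v : ∀ p q, (I.cocomplex.X q).obj (copower c p) →ₗ[K]
    (I.cocomplex.X (q + 1)).obj (copower c p) :=
      fun p q => ((I.cocomplex.d q (q + 1)).app (copower c p)).hom
  let j : G ⟶ I.cocomplex.X 0 := I.ι.f 0
  have hj : j ≫ I.cocomplex.d 0 1 = 0 := I.ι_f_zero_comp_complex_d
  have hjm : Mono j := inferInstanceAs (Mono (I.ι.f 0))
  have hje : (ShortComplex.mk j _ hj).Exact := I.exact₀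
  have hji : ∀ x, Function.Injective (j.app x).hom := fun x =>
    (ModuleCat.mono_iff_injective _).1 inferInstance
  obtain ⟨e₁⟩ := nonempty_edge_equiv h v
    (fun p q x => cofaceSum_naturality c (I.cocomplex.d q (q + 1)) p x)
    (fun p q x => cofaceSum_comp c _ p x)
    (fun p q x => congrArg (fun t => (t.app (copower c p)).hom x)
      (I.cocomplex.d_comp_d q (q + 1) (q + 2)))
    (fun p q x hx => injective_exact c e (I.cocomplex.X q) p x hx)
    (fun p q x hx => exists_of_exact _ (I.exact_succ q) _ x hx) n
  have hr : ∀ p, LinearMap.range (j.app (copower c p)).hom = LinearMap.ker (v p 0) := fun p => by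
    apply le_antisymm
    · rintro _ ⟨x, rfl⟩
      exact congrArg (fun t => (t.app (copower c p)).hom x) hj
    · intro x hx
      exact exists_of_exact hj hje _ x hx
  -- The edge `q = 0`: the kernel of the first vertical map is `G(c^p)`, so this edge computes the
  -- cohomology of `G(c^•)`.
  obtain ⟨e₂⟩ := nonempty_midHomology_equiv_subQuotient (f := cofaceSum c G n)
    (g := cofaceSum c G (n + 1)) (F := h n 0) (G := h (n + 1) 0)
    (j.app (copower c n)).hom (j.app (copower c (n + 1))).hom (j.app (copower c (n + 2))).hom
    (hji _) (hji _) (fun x => cofaceSum_naturality c j n x)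
    (fun x => cofaceSum_naturality c j (n + 1) x) (hr (n + 1)) (hr n)
  let L := ((lim : (J ⥤ ModuleCat.{u + 1} K) ⥤ ModuleCat.{u + 1} K).mapHomologicalComplex
    (ComplexShape.up ℕ)).obj I.cocomplex
  have hπ : ∀ q (x : (limit (I.cocomplex.X q) : ModuleCat.{u + 1} K)),
      v 0 q (limitProj c (I.cocomplex.X q) x) =
        limitProj c (I.cocomplex.X (q + 1)) ((L.d q (q + 1)).hom x) := fun q x =>
    (congrArg (fun t => t.hom x) (limMap_π (I.cocomplex.d q (q + 1)) (copower c 0))).symm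
  -- The edge `p = 0`: the kernel of the first horizontal map is `lim I^q`, so this edge computes
  -- the derived functors of the limit.
  obtain ⟨e₃⟩ := nonempty_midHomology_equiv_subQuotient (f := (L.d n (n + 1)).hom)
    (g := (L.d (n + 1) (n + 2)).hom) (F := v 0 n) (G := v 0 (n + 1))
    (limitProj c (I.cocomplex.X n)) (limitProj c (I.cocomplex.X (n + 1)))
    (limitProj c (I.cocomplex.X (n + 2)))
    (limitProj_injective c e _) (limitProj_injective c e _) (hπ n) (hπ (n + 1))
    (range_limitProj c e _) (range_limitProj c e _)
  have e₄ : L.homology (n + 1) ≃ₗ[K] _ :=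
    homologyEquiv L n (n + 1) (n + 2) (by simp) (by simp only [CochainComplex.next]; rfl)
  exact ⟨(I.isoRightDerivedObj _ (n + 1)).toLinearEquiv ≪≫ₗ e₄ ≪≫ₗ e₃ ≪≫ₗ e₁ ≪≫ₗ e₂.symm⟩

theorem nonempty_rightDerived_zero_equiv (c : J) (e : ∀ d, c ⟶ d) (G : J ⥤ ModuleCat.{u + 1} K) :
    Nonempty (((lim : (J ⥤ ModuleCat.{u + 1} K) ⥤ ModuleCat.{u + 1} K).rightDerived 0).obj G
      ≃ₗ[K] LinearMap.ker (cofaceSum c G 0)) := by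
  have : PreservesFiniteLimits (lim : (J ⥤ ModuleCat.{u + 1} K) ⥤ ModuleCat.{u + 1} K) :=
    inferInstance
  exact ⟨((Functor.rightDerivedZeroIsoSelf lim).app G).toLinearEquiv ≪≫ₗ
    LinearEquiv.ofInjective _ (limitProj_injective c e G) ≪≫ₗ
    LinearEquiv.ofEq _ _ (range_limitProj c e G)⟩

theorem cofaceSum_down (c : J) (F : J ⥤ ModuleCat.{u} K) (n : ℕ)
    (x : (F ⋙ ModuleCat.uliftFunctor.{u + 1} K).obj (copower c n)) :
    ULift.moduleEquiv (R := K)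
        (cofaceSum c (F ⋙ ModuleCat.uliftFunctor.{u + 1} K) n x : ULift (F.obj _)) =
      cofaceSum c F n (ULift.moduleEquiv (R := K) (x : ULift (F.obj (copower c n)))) := by
  rw [cofaceSum_apply, cofaceSum_apply]
  refine (map_sum (ULift.moduleEquiv (R := K) (M := F.obj (copower c (n + 1)))) _ _).trans ?_
  exact Finset.sum_congr rfl fun l _ =>
    map_zsmul (ULift.moduleEquiv (R := K) (M := F.obj (copower c (n + 1)))) _ _

/-- The universe lift in the definition of `higherLim` commutes with the coface sums, so it can be
removed degreewise. -/
theorem nonempty_higherLim_succ_equiv (c : J) (e : ∀ d, c ⟶ d) (F : J ⥤ ModuleCat.{u} K)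
    (n : ℕ) : Nonempty (higherLim F (n + 1) ≃ₗ[K]
      midHomology (cofaceSum c F n) (cofaceSum c F (n + 1))) := by
  obtain ⟨e₁⟩ := nonempty_rightDerived_succ_equiv c e (F ⋙ ModuleCat.uliftFunctor.{u + 1} K) n
  let E : ∀ n, (F ⋙ ModuleCat.uliftFunctor.{u + 1} K).obj (copower c n) ≃ₗ[K]
    F.obj (copower c n) := fun n => ULift.moduleEquiv (R := K) (M := F.obj (copower c n))
  have hE : ∀ n x, E (n + 1) (cofaceSum c _ n x) = cofaceSum c F n (E n x) :=
    fun n x => cofaceSum_down c F n x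
  refine ⟨e₁ ≪≫ₗ midHomologyCongr (E (n + 1)) (fun x => ?_) fun x => ?_⟩
  · rw [← hE, LinearEquiv.map_eq_zero_iff]
  · constructor
    · rintro ⟨y, rfl⟩
      exact ⟨E n y, (hE n y).symm⟩
    · rintro ⟨y, hy⟩
      refine ⟨(E n).symm y, (E (n + 1)).injective ?_⟩
      rw [hE, LinearEquiv.apply_symm_apply, hy]

theorem nonempty_higherLim_zero_equiv (c : J) (e : ∀ d, c ⟶ d) (F : J ⥤ ModuleCat.{u} K) :
    Nonempty (higherLim F 0 ≃ₗ[K] LinearMap.ker (cofaceSum c F 0)) := by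
  obtain ⟨e₁⟩ := nonempty_rightDerived_zero_equiv c e (F ⋙ ModuleCat.uliftFunctor.{u + 1} K)
  let E : ∀ n, (F ⋙ ModuleCat.uliftFunctor.{u + 1} K).obj (copower c n) ≃ₗ[K]
    F.obj (copower c n) := fun n => ULift.moduleEquiv (R := K) (M := F.obj (copower c n))
  have hE : ∀ n x, E (n + 1) (cofaceSum c _ n x) = cofaceSum c F n (E n x) :=
    fun n x => cofaceSum_down c F n x
  refine ⟨e₁ ≪≫ₗ (E 0).ofSubmodules _ _ ?_⟩
  ext x
  rw [Submodule.mem_map_equiv, LinearMap.mem_ker, LinearMap.mem_ker,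
    ← (E 1).map_eq_zero_iff, hE, LinearEquiv.apply_symm_apply]

end HigherLimitsOfStandardComplex

/-! ### The identity presentation and the assembly of the main theorem -/

section MainTheorem

open AlgebraicTopology

variable {K : Type u} [CommRing K]

/-- A free module with the identity is weakly initial among its presentations. -/
theorem nonempty_idPres_hom (A : ModuleCat.{u} K) [Module.Free K A] (p : Pres A) :
    Nonempty (idPres A ⟶ p) := by
  have : Module.Projective K A := Module.Projective.of_free
  obtain ⟨s, hs⟩ := Module.projective_lifting_property p.obj.hom.hom LinearMap.id p.property.2
  exact ⟨ObjectProperty.homMk (Over.homMk (ModuleCat.ofHom s) (ModuleCat.hom_ext hs))⟩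

theorem exists_equiv_dual (V : SimplicialObject (ModuleCat.{u} K)) {J : Type (u + 1)}
    [Category.{u} J] [∀ n : ℕ, HasCoproductsOfShape (Fin (n + 1)) J] (c : J)
    (F : J ⥤ ModuleCat.{u} K)
    (e : ((CosimplicialObject.whiskering _ _).obj F).obj (copowers c) ≅ dualCosimplicial V) :
    ∃ E : ∀ n, F.obj (copower c n) ≃ₗ[K]
      Module.Dual K (((alternatingFaceMapComplex _).obj V).X n),
      ∀ n x, E (n + 1) (cofaceSum c F n x) =
        (((alternatingFaceMapComplex _).obj V).d (n + 1) n).hom.dualMap (E n x) := by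
  let t := (alternatingCofaceMapComplex _).mapIso e
  refine ⟨fun n => ((HomologicalComplex.eval _ _ n).mapIso t).toLinearEquiv, fun n x => ?_⟩
  rw [← cofaceSum_eq]
  refine (congrArg (fun g => g.hom x) (t.hom.comm n (n + 1))).symm.trans ?_
  exact congrArg (fun g => g.hom ((t.hom.f n).hom x)) (dualCosimplicial_d V n)

variable [IsDomain K] [IsPrincipalIdealRing K] (A : ModuleCat.{u} K) [Module.Free K A]
  [Module.Finite K A] (Φ : ModuleCat.{u} K ⥤ ModuleCat.{u} K)
  (hΦ : ∀ M : ModuleCat.{u} K, Module.Free K M → Module.Finite K M →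
    Module.Free K (Φ.obj M) ∧ Module.Finite K (Φ.obj M))

include hΦ

/-- In each degree the module is isomorphic to the dual of `Φ(M^∨∨)` with `M` a module of relations.
The universal coefficient sequence needs this freeness. -/
theorem finite_free_kuhnDual_eilenbergMacLane (n : ℕ) :
    Module.Free K (((alternatingFaceMapComplex _).obj
      (applySimplicial (kuhnDual Φ) (eilenbergMacLane (dualMod A) 1))).X n) ∧
    Module.Finite K (((alternatingFaceMapComplex _).obj
      (applySimplicial (kuhnDual Φ) (eilenbergMacLane (dualMod A) 1))).X n) := by
  obtain ⟨e⟩ := nonempty_eilenbergMacLane_iso A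
  obtain ⟨h1, h2⟩ := finite_free_relations A (SimplexCategory.mk n)
  let M : ModuleCat.{u} K := (relationsCosimplicial A).obj (SimplexCategory.mk n)
  have : Module.Free K M := h1
  have : Module.Finite K M := h2
  obtain ⟨h3, h4⟩ := hΦ (dualMod (dualMod M)) inferInstance inferInstance
  let E : dualMod (Φ.obj (dualMod (dualMod M))) ≅ ((alternatingFaceMapComplex _).obj
      (applySimplicial (kuhnDual Φ) (eilenbergMacLane (dualMod A) 1))).X n :=
    (kuhnDual Φ).mapIso (e.symm.app (op (SimplexCategory.mk n)))
  have : Module.Free K (dualMod (Φ.obj (dualMod (dualMod M)))) := inferInstance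
  exact ⟨Module.Free.of_equiv E.toLinearEquiv, Module.Finite.equiv E.toLinearEquiv⟩

end MainTheorem

end RelLim

end

open RelLim AlgebraicTopology in
theorem mainTheorem6 {K : Type u} [CommRing K] [IsDomain K] [IsPrincipalIdealRing K]
    (A : ModuleCat.{u} K) [Module.Free K A] [Module.Finite K A]
    (Φ : ModuleCat.{u} K ⥤ ModuleCat.{u} K)
    (hΦ : ∀ M : ModuleCat.{u} K, Module.Free K M → Module.Finite K M →
      Module.Free K (Φ.obj M) ∧ Module.Finite K (Φ.obj M)) :
    Nonempty (RelLim.limComplex (RelLim.idPres A) (RelLim.relations A ⋙ Φ) ≅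
      RelLim.dualComplex (RelLim.normalizedChain (RelLim.applySimplicial (RelLim.kuhnDual Φ)
        (RelLim.eilenbergMacLane (RelLim.dualMod A) 1)))) ∧
    Nonempty (RelLim.limComplex (RelLim.idPres A) (RelLim.relations A ⋙ Φ) ≅
      RelLim.dualComplex (RelLim.normalizedChain (RelLim.applySimplicial (RelLim.kuhnDual Φ)
        (RelLim.eilenbergMacLane A 1)))) ∧
    Nonempty (RelLim.higherLim (RelLim.relations A ⋙ Φ) 0 ≃ₗ[K]
      RelLim.dualMod (RelLim.doldPuppe (RelLim.kuhnDual Φ) (RelLim.dualMod A) 1 0)) ∧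
    ∀ i : ℕ,
      ∃ (f : RelLim.extDual (RelLim.doldPuppe (RelLim.kuhnDual Φ) (RelLim.dualMod A) 1 i) →ₗ[K]
          RelLim.higherLim (RelLim.relations A ⋙ Φ) (i + 1))
        (g : RelLim.higherLim (RelLim.relations A ⋙ Φ) (i + 1) →ₗ[K]
          RelLim.dualMod (RelLim.doldPuppe (RelLim.kuhnDual Φ) (RelLim.dualMod A) 1 (i + 1))),
        Function.Injective f ∧ Function.Exact f g ∧ Function.Surjective g := by
  let V := applySimplicial (kuhnDual Φ) (eilenbergMacLane (dualMod A) 1)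
  let X := (alternatingFaceMapComplex _).obj V
  have hfree : ∀ n, Module.Free K (X.X n) :=
    fun n => (finite_free_kuhnDual_eilenbergMacLane A Φ hΦ n).1
  have hfin : ∀ n, Module.Finite K (X.X n) :=
    fun n => (finite_free_kuhnDual_eilenbergMacLane A Φ hΦ n).2
  let e : ∀ p, idPres A ⟶ p := fun p => (nonempty_idPres_hom A p).some
  obtain ⟨t⟩ := nonempty_cosimplicial_iso A Φ hΦ
  obtain ⟨E, hE⟩ := exists_equiv_dual V (idPres A) (relations A ⋙ Φ) t
  have : Projective (dualMod A) := (IsProjective.iff_projective _).1 inferInstance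
  have D : ∀ n i k, (ComplexShape.down ℕ).prev n = i → (ComplexShape.down ℕ).next n = k →
      Nonempty (midHomology (X.d i n).hom (X.d n k).hom ≃ₗ[K]
        doldPuppe (kuhnDual Φ) (dualMod A) 1 n) := fun n i k hi hk => by
    obtain ⟨a⟩ := nonempty_doldPuppe_iso (kuhnDual Φ) (dualMod A) n
    let b : X.homology n ≃ₗ[K] _ := homologyEquiv X i n k hi hk
    exact ⟨b.symm ≪≫ₗ a.symm.toLinearEquiv⟩
  have hprev : ∀ n : ℕ, (ComplexShape.down ℕ).prev n = n + 1 := by simp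
  have hnext : ∀ n : ℕ, (ComplexShape.down ℕ).next (n + 1) = n := by simp
  have hnext0 : (ComplexShape.down ℕ).next 0 = 0 := by simp
  refine ⟨nonempty_limComplex_iso A Φ hΦ (Iso.refl _), nonempty_limComplex_iso A Φ hΦ
    (Module.Free.chooseBasis K A).toDualEquiv.symm.toModuleIso, ?_, fun i => ?_⟩
  · obtain ⟨a⟩ := nonempty_higherLim_zero_equiv (idPres A) e (relations A ⋙ Φ)
    obtain ⟨b⟩ := nonempty_dual_midHomology_zero (K := K) (Y := X.X 0) (X.d 1 0).hom
    obtain ⟨d⟩ := D 0 1 0 (hprev 0) hnext0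
    have h0 : (X.d 0 0).hom = 0 := congrArg ModuleCat.Hom.hom (X.shape 0 0 (by simp))
    rw [h0] at d
    refine ⟨a ≪≫ₗ (E 0).ofSubmodules _ (LinearMap.ker (X.d 1 0).hom.dualMap) ?_ ≪≫ₗ b ≪≫ₗ
      d.symm.dualMap⟩
    ext x
    rw [Submodule.mem_map_equiv, LinearMap.mem_ker, LinearMap.mem_ker,
      ← (E 1).map_eq_zero_iff, hE, LinearEquiv.apply_symm_apply]
  · obtain ⟨a⟩ := nonempty_higherLim_succ_equiv (idPres A) e (relations A ⋙ Φ) i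
    obtain ⟨d₁⟩ := D (i + 1) (i + 2) i (hprev _) (hnext _)
    -- Leaving the target degree `k` unspecified treats `i = 0`, where it is `0` and the
    -- differential vanishes, together with `i > 0`, where it is `i - 1`.
    obtain ⟨k, hk, d₀⟩ : ∃ k, X.d (i + 1) i ≫ X.d i k = 0 ∧
        Nonempty (midHomology (X.d (i + 1) i).hom (X.d i k).hom ≃ₗ[K]
          doldPuppe (kuhnDual Φ) (dualMod A) 1 i) :=
      ⟨_, X.d_comp_d _ _ _, D i (i + 1) _ (hprev i) rfl⟩
    obtain ⟨d₀⟩ := d₀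
    refine exists_universal_coefficients (X.d (i + 2) (i + 1)).hom (X.d (i + 1) i).hom
      (X.d i k).hom ?_ ?_ _ _ d₀ d₁ (LinearEquiv.symm (a ≪≫ₗ midHomologyCongr (E (i + 1))
        (fun x => ?_) fun x => ?_))
    · exact congrArg ModuleCat.Hom.hom (X.d_comp_d (i + 2) (i + 1) i)
    · exact congrArg ModuleCat.Hom.hom hk
    · rw [← hE, LinearEquiv.map_eq_zero_iff]
    · constructor
      · rintro ⟨y, rfl⟩
        exact ⟨E i y, (hE i y).symm⟩
      · rintro ⟨y, hy⟩
        refine ⟨(E i).symm y, (E (i + 1)).injective ?_⟩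
        rw [hE, LinearEquiv.apply_symm_apply, hy]
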